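/- Let $K>0$ and let $S^n\subset\mathbb{R}^{n+1}$ be the round sphere of radius $1/\sqrt{K}$, i.e. of constant curvature $K$. Let $(M,g)$ be a smooth Riemannian manifold of dimension $m$ without boundary, and let $\phi\colon M\to S^n$ be a smooth isometric immersion. Let $\bar\nabla$ be the pull-back to $\phi^*TS^n$ of the Levi-Civita connection of $S^n$, let $\tau(\phi)=\operatorname{Tr}_g\bar\nabla d\phi$ be the tension field of $\phi$, and let $\bar\Delta=\operatorname{Tr}_g(\bar\nabla\bar\nabla)$ be the connection Laplacian on sections of $\phi^*TS^n$. Let $\delta_1,\delta_2\in\mathbb{R}$ with $\delta_2\neq 0$, and suppose that $$\bar\Delta\tau(\phi)=\Big(-mK+\frac{\delta_1}{\delta_2}\Big)\tau(\phi)\quad\text{on } M,\qquad -mK+\frac{\delta_1}{\delta_2}\ge 0.$$ Then the following statements hold. 1. If $M$ is closed (compact without boundary), then $\phi$ is harmonic, i.e. $\tau(\phi)=0$. 2. If $M$ is complete and non-compact and $\phi$ has finite bienergy, $E_2(\phi)=\int_M|\tau(\phi)|^2\,dV<\infty$, then $\phi$ is harmonic. -/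

import Mathlib

open Set MeasureTheory Bundle Manifold
open scoped ENNReal ContDiff Manifold

noncomputable section

namespace SphereImmersion

section Domain

/-! Riemannian geometry of a manifold `M` of dimension `m` without boundary, in the preferred
charts of its atlas. The metric is the inner product on the tangent spaces. -/

variable (m : ℕ) {M : Type*} [TopologicalSpace M] [ChartedSpace (EuclideanSpace ℝ (Fin m)) M]

/-- The inverse of the preferred chart at `x₀`, defined on an open subset of `ℝ^m`. -/
def param (x₀ : M) : EuclideanSpace ℝ (Fin m) → M :=
  (extChartAt (𝓡 m) x₀).symm

/-- The coordinate vector field `∂_i` of the chart at `x₀`, at the point with coordinates `y`. -/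
def coordVec (x₀ : M) (i : Fin m) (y : EuclideanSpace ℝ (Fin m)) :
    TangentSpace (𝓡 m) (param m x₀ y) :=
  mfderiv (𝓡 m) (𝓡 m) (param m x₀) y (EuclideanSpace.single i (1 : ℝ))

/-- The partial derivative `∂_i f` of a function of the coordinates. -/
def partialD {m : ℕ} {F : Type*} [NormedAddCommGroup F] [NormedSpace ℝ F] (i : Fin m)
    (f : EuclideanSpace ℝ (Fin m) → F) (y : EuclideanSpace ℝ (Fin m)) : F :=
  fderiv ℝ f y (EuclideanSpace.single i (1 : ℝ))

variable [RiemannianBundle (fun x : M => TangentSpace (𝓡 m) x)]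

/-- The coefficients `g_ij` of the Riemannian metric in the chart at `x₀`. -/
def metricMatrix (x₀ : M) (y : EuclideanSpace ℝ (Fin m)) : Matrix (Fin m) (Fin m) ℝ :=
  Matrix.of fun i j => inner ℝ (coordVec m x₀ i y) (coordVec m x₀ j y)

/-- The Christoffel symbols
`Γ^k_ij = (1/2) ∑_l g^{kl} (∂_i g_jl + ∂_j g_il - ∂_l g_ij)` of the Levi-Civita connection
in the chart at `x₀`. -/
def christoffel (x₀ : M) (k i j : Fin m) (y : EuclideanSpace ℝ (Fin m)) : ℝ :=
  (1 / 2 : ℝ) * ∑ l : Fin m, (metricMatrix m x₀ y)⁻¹ k l *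
    (partialD i (fun z => metricMatrix m x₀ z j l) y
      + partialD j (fun z => metricMatrix m x₀ z i l) y
      - partialD l (fun z => metricMatrix m x₀ z i j) y)

/-- The Riemannian volume of the domain of the chart at `x₀`: the image under the inverse chart of
the measure `√(det g_ij) dy` on the chart's target. -/
def chartVolume [MeasurableSpace M] (x₀ : M) : Measure M :=
  Measure.map (param m x₀)
    ((volume.restrict (extChartAt (𝓡 m) x₀).target).withDensity
      fun y => ENNReal.ofReal (Real.sqrt (metricMatrix m x₀ y).det))

/-- The Riemannian volume measure `dV`, glued from the chart measures. These agree on overlaps of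
chart domains, so their supremum in the lattice of measures is the measure that restricts to
`chartVolume m x₀` on the domain of each chart. -/
def riemannianVolume (M : Type*) [TopologicalSpace M]
    [ChartedSpace (EuclideanSpace ℝ (Fin m)) M]
    [RiemannianBundle (fun x : M => TangentSpace (𝓡 m) x)] [MeasurableSpace M] : Measure M :=
  ⨆ x₀ : M, chartVolume m x₀

end Domain

section Target

/-! Maps `φ` from `M` to the sphere `S^n` of radius `r` about the origin of `ℝ^{n+1}` with the
induced round metric. Tangent vectors of `S^n` at `q` are the vectors of `ℝ^{n+1}` orthogonal
to `q`. -/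

variable (m : ℕ) {n : ℕ} {r : ℝ} {M : Type*} [TopologicalSpace M]
  [ChartedSpace (EuclideanSpace ℝ (Fin m)) M]

/-- The composition of `φ` with the inclusion of the sphere in `ℝ^{n+1}`. -/
def incl {M : Type*} {n : ℕ} {r : ℝ} (φ : M → Metric.sphere (0 : EuclideanSpace ℝ (Fin (n + 1))) r) :
    M → EuclideanSpace ℝ (Fin (n + 1)) :=
  fun p => (φ p : EuclideanSpace ℝ (Fin (n + 1)))

/-- The differential `dφ_p : T_p M → T_{φ(p)} S^n ⊆ ℝ^{n+1}`. -/
def differential (φ : M → Metric.sphere (0 : EuclideanSpace ℝ (Fin (n + 1))) r) (p : M) :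
    TangentSpace (𝓡 m) p →L[ℝ] EuclideanSpace ℝ (Fin (n + 1)) :=
  mvfderiv (𝓡 m) (incl φ) p

/-- The orthogonal projection of `ℝ^{n+1}` onto `T_q S^n`, the orthogonal complement of `q`. -/
def tangentProj {n : ℕ} (q : EuclideanSpace ℝ (Fin (n + 1))) :
    EuclideanSpace ℝ (Fin (n + 1)) →L[ℝ] EuclideanSpace ℝ (Fin (n + 1)) :=
  (Submodule.span ℝ {q})ᗮ.starProjection

/-- The pull-back `∇̄` of the Levi-Civita connection of `S^n` to `φ^*TS^n`: for a section `V`,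
`∇̄_v V` is the tangential part of the derivative of `V : M → ℝ^{n+1}` in the direction `v`. -/
def pullbackConn (φ : M → Metric.sphere (0 : EuclideanSpace ℝ (Fin (n + 1))) r)
    (V : M → EuclideanSpace ℝ (Fin (n + 1))) (p : M) :
    TangentSpace (𝓡 m) p →L[ℝ] EuclideanSpace ℝ (Fin (n + 1)) :=
  (tangentProj (incl φ p)).comp (mvfderiv (𝓡 m) V p)

variable [RiemannianBundle (fun x : M => TangentSpace (𝓡 m) x)]

/-- The trace `Tr_g ∇̄α` for a one-form `α` on `M` with values in `φ^*TS^n`, where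
`(∇̄α)(X, Y) = ∇̄_X (α(Y)) - α(∇_X Y)` with `∇` the Levi-Civita connection of `M`. In the chart
at `p` it is `∑_ij g^{ij} (∇̄_i (α(∂_j)) - ∑_k Γ^k_ij α(∂_k))`. -/
def traceConn (φ : M → Metric.sphere (0 : EuclideanSpace ℝ (Fin (n + 1))) r)
    (α : ∀ p : M, TangentSpace (𝓡 m) p →L[ℝ] EuclideanSpace ℝ (Fin (n + 1))) (p : M) :
    EuclideanSpace ℝ (Fin (n + 1)) :=
  let y := extChartAt (𝓡 m) p p
  ∑ i : Fin m, ∑ j : Fin m, (metricMatrix m p y)⁻¹ i j •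
    (tangentProj (incl φ p) (partialD i (fun z => α (param m p z) (coordVec m p j z)) y)
      - ∑ k : Fin m, christoffel m p k i j y • α (param m p y) (coordVec m p k y))

/-- The tension field `τ(φ) = Tr_g ∇̄dφ`. -/
def tensionField (φ : M → Metric.sphere (0 : EuclideanSpace ℝ (Fin (n + 1))) r) :
    M → EuclideanSpace ℝ (Fin (n + 1)) :=
  traceConn m φ (differential m φ)

/-- The connection Laplacian `Δ̄V = Tr_g ∇̄∇̄V` of a section `V` of `φ^*TS^n`. -/
def connLaplacian (φ : M → Metric.sphere (0 : EuclideanSpace ℝ (Fin (n + 1))) r)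
    (V : M → EuclideanSpace ℝ (Fin (n + 1))) : M → EuclideanSpace ℝ (Fin (n + 1)) :=
  traceConn m φ (pullbackConn m φ V)

/-- A map to the sphere is a smooth isometric immersion if it is smooth (equivalently, smooth as a
map to the ambient `ℝ^{n+1}`, the sphere being an embedded submanifold) and `⟨dφ v, dφ w⟩ = g(v, w)`
for all tangent vectors. Such a differential is automatically injective. -/
structure IsSmoothIsometricImmersion
    (φ : M → Metric.sphere (0 : EuclideanSpace ℝ (Fin (n + 1))) r) : Prop where
  smooth : ContMDiff (𝓡 m) 𝓘(ℝ, EuclideanSpace ℝ (Fin (n + 1))) ∞ (incl φ)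
  isometric : ∀ (p : M) (v w : TangentSpace (𝓡 m) p),
    inner ℝ (differential m φ p v) (differential m φ p w) = inner ℝ v w

/-- Harmonic maps: the tension field vanishes. -/
def IsHarmonic (φ : M → Metric.sphere (0 : EuclideanSpace ℝ (Fin (n + 1))) r) : Prop :=
  ∀ p : M, tensionField m φ p = 0

/-- The bienergy `E₂(φ) = ∫_M |τ(φ)|² dV`, with values in `[0, ∞]`. -/
def bienergy [MeasurableSpace M]
    (φ : M → Metric.sphere (0 : EuclideanSpace ℝ (Fin (n + 1))) r) : ℝ≥0∞ :=
  ∫⁻ p, ENNReal.ofReal (‖tensionField m φ p‖ ^ 2) ∂(riemannianVolume m M)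

end Target

end SphereImmersion

end

/-! Write `τ` for the tension field, `u = |τ|²`, and `c ≥ 0` for the factor in `Δ̄τ = cτ`. The proof
is a Bochner identity combined with a Caccioppoli estimate.

Everything is expressed through the ambient map `Φ = incl φ` in charts. As `φ` is isometric, the
metric is the Gram matrix of the `∂_i Φ`, and `τ = ΔΦ + mKΦ` (`tensionField_eq`). Hence `τ` is
orthogonal both to `Φ` and to the image of `dΦ`. Differentiating `⟨τ, Φ⟩ = 0` shows that the
derivatives of `τ` in `ℝ^{n+1}` are already tangent to the sphere, so `∇̄τ = dτ`, and `⟨Δ̄τ, τ⟩ =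
⟨Δτ, τ⟩` with the componentwise Laplacian. This gives `Δu = 2cu + 2|dτ|²`
(`manifoldLap_inner_tensionField`), and therefore `|dτ|² ≤ Δu - |dτ|²`.

For a cut-off `η` with Lipschitz constant `L`, Green's formula, Cauchy–Schwarz and Young's
inequality give `∫ η² (Δu - |dτ|²) ≤ 4 L² ∫ u` (`integral_sq_mul_manifoldLap_sub_le`). Completeness
makes bounded closed balls compact (`isCompact_closedEBall`), so there are cut-offs equal to `1` on
a given unit ball with `L = 1/R` for every `R > 0`. When `∫ u` is finite, `R → ∞` forces `dτ = 0`.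

Finally `dτ = 0` implies `τ = 0` (`tensionField_eq_zero`): differentiating `⟨τ, ∂_j Φ⟩ = 0` and
taking the trace yields `0 = -⟨τ, ΔΦ⟩ = -|τ|²`. On a closed manifold completeness and the finiteness
of `∫ u` are automatic, so both statements follow from `isHarmonic_of_integrable`.

The distance gives cut-offs that are only Lipschitz. They are differentiated almost everywhere in
charts by Rademacher's theorem, and the local inequalities are glued by a partition of unity. This
requires the Laplacian, the gradient pairing and the volume to be independent of the chart. -/

open scoped NNReal

noncomputable section

namespace SphereImmersion

/-! ### Derivatives of determinants and inverse matrices. -/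

section MatrixCalculus

variable {ι : Type*} [Fintype ι] [DecidableEq ι] {E : Type*} [NormedAddCommGroup E]
  [NormedSpace ℝ E]

/-- Jacobi's formula for the derivative of a determinant. -/
theorem hasFDerivAt_det {G : E → Matrix ι ι ℝ} {G' : ι → ι → E →L[ℝ] ℝ} {y : E}
    (hG : ∀ i j, HasFDerivAt (fun z => G z i j) (G' i j) y) :
    HasFDerivAt (fun z => (G z).det) (∑ i, ∑ j, (G y).adjugate j i • G' i j) y := by
  let D : ContinuousMultilinearMap ℝ (fun _ : ι => ι → ℝ) ℝ :=
    ⟨(Matrix.detRowAlternating : (ι → ℝ) [⋀^ι]→ₗ[ℝ] ℝ).toMultilinearMap,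
      Continuous.matrix_det continuous_id⟩
  have h1 : HasFDerivAt (fun z i j => G z i j)
      (ContinuousLinearMap.pi fun i => ContinuousLinearMap.pi fun j => G' i j) y :=
    hasFDerivAt_pi.2 fun i => hasFDerivAt_pi.2 fun j => hG i j
  have h2 := (D.hasFDerivAt (G y)).comp y h1
  refine h2.congr_fderiv ?_
  ext v
  have h3 := D.linearDeriv_apply (G y) (fun i j => G' i j v)
  refine h3.trans ?_
  simp only [sum_apply, smul_apply]
  refine Finset.sum_congr rfl fun i _ => ?_
  change ((G y).updateRow i (fun j => G' i j v)).det = _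
  rw [← Matrix.cramer_transpose_apply, Matrix.cramer_eq_adjugate_mulVec,
    ← Matrix.adjugate_transpose]
  simp [Matrix.mulVec, dotProduct]

theorem contDiffAt_det {G : E → Matrix ι ι ℝ} {N : WithTop ℕ∞} {y : E}
    (hG : ∀ i j, ContDiffAt ℝ N (fun z => G z i j) y) :
    ContDiffAt ℝ N (fun z => (G z).det) y := by
  simp only [Matrix.det_apply']
  exact ContDiffAt.sum fun σ _ => contDiffAt_const.mul (contDiffAt_prod fun i _ => hG _ _)

theorem contDiffAt_matrix_inv {G : E → Matrix ι ι ℝ} {N : WithTop ℕ∞} {y : E}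
    (hG : ∀ i j, ContDiffAt ℝ N (fun z => G z i j) y) (hdet : (G y).det ≠ 0) (i j : ι) :
    ContDiffAt ℝ N (fun z => (G z)⁻¹ i j) y := by
  simp only [Matrix.inv_def, Ring.inverse_eq_inv', Matrix.smul_apply, Matrix.adjugate_apply]
  refine ((contDiffAt_det hG).inv hdet).smul (contDiffAt_det fun a b => ?_)
  by_cases h : a = j
  · subst h
    simpa using contDiffAt_const
  · simpa [Matrix.updateRow_ne h] using hG a b

theorem fderiv_det {G : E → Matrix ι ι ℝ} {y : E}
    (hG : ∀ i j, DifferentiableAt ℝ (fun z => G z i j) y) (hdet : (G y).det ≠ 0) (v : E) :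
    fderiv ℝ (fun z => (G z).det) y v
      = (G y).det * ∑ i, ∑ j, (G y)⁻¹ j i * fderiv ℝ (fun z => G z i j) y v := by
  rw [(hasFDerivAt_det fun i j => (hG i j).hasFDerivAt).fderiv]
  simp only [sum_apply, smul_apply, Finset.mul_sum]
  refine Finset.sum_congr rfl fun i _ => Finset.sum_congr rfl fun j _ => ?_
  simp only [Matrix.inv_def, Ring.inverse_eq_inv', Matrix.smul_apply, smul_eq_mul]
  field_simp

theorem fderiv_matrix_inv {G : E → Matrix ι ι ℝ} {y : E}
    (hG : ∀ i j, ContDiffAt ℝ 1 (fun z => G z i j) y) (hdet : (G y).det ≠ 0) (i j : ι) (v : E) :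
    fderiv ℝ (fun z => (G z)⁻¹ i j) y v
      = -∑ a, ∑ b, (G y)⁻¹ i a * fderiv ℝ (fun z => G z a b) y v * (G y)⁻¹ b j := by
  have hI : ∀ a b, DifferentiableAt ℝ (fun z => (G z)⁻¹ a b) y := fun a b =>
    (contDiffAt_matrix_inv hG hdet a b).differentiableAt one_ne_zero
  have hd : ∀ a b, DifferentiableAt ℝ (fun z => G z a b) y := fun a b =>
    (hG a b).differentiableAt one_ne_zero
  have hne : ∀ᶠ z in nhds y, (G z).det ≠ 0 :=
    (contDiffAt_det hG).continuousAt.eventually_ne hdet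
  let D : Matrix ι ι ℝ := Matrix.of fun a b => fderiv ℝ (fun z => (G z)⁻¹ a b) y v
  let D' : Matrix ι ι ℝ := Matrix.of fun a b => fderiv ℝ (fun z => G z a b) y v
  -- The product rule for `G⁻¹ G = 1`, which holds near `y` because the determinant stays nonzero
  -- there.
  have key : D * G y + (G y)⁻¹ * D' = 0 := by
    ext a b
    have h1 : HasFDerivAt (fun z => ∑ c, (G z)⁻¹ a c * G z c b)
        (∑ c, ((G y)⁻¹ a c • fderiv ℝ (fun z => G z c b) y
          + G y c b • fderiv ℝ (fun z => (G z)⁻¹ a c) y)) y :=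
      HasFDerivAt.fun_sum fun c _ => (hI a c).hasFDerivAt.mul (hd c b).hasFDerivAt
    have h2 : HasFDerivAt (fun z => ∑ c, (G z)⁻¹ a c * G z c b) (0 : E →L[ℝ] ℝ) y := by
      refine (hasFDerivAt_const ((1 : Matrix ι ι ℝ) a b) y).congr_of_eventuallyEq ?_
      filter_upwards [hne] with z hz
      rw [← Matrix.mul_apply, Matrix.nonsing_inv_mul _ (isUnit_iff_ne_zero.2 hz)]
    have h3 := congrArg (fun L : E →L[ℝ] ℝ => L v) (h1.unique h2)
    simp only [sum_apply, add_apply, smul_apply, smul_eq_mul, zero_apply] at h3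
    simp only [Matrix.add_apply, Matrix.mul_apply, Matrix.zero_apply, ← Finset.sum_add_distrib]
    rw [← h3]
    exact Finset.sum_congr rfl fun c _ => by simp only [D, D', Matrix.of_apply]; ring
  have h4 : D = -((G y)⁻¹ * D' * (G y)⁻¹) := by
    have h5 := congrArg (· * (G y)⁻¹) key
    simp only [add_mul, zero_mul, Matrix.mul_assoc,
      Matrix.mul_nonsing_inv _ (isUnit_iff_ne_zero.2 hdet), mul_one] at h5
    rw [Matrix.mul_assoc]
    exact eq_neg_of_add_eq_zero_left h5
  have h6 := congrFun (congrFun h4 i) j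
  simp only [D, Matrix.of_apply] at h6
  rw [h6, Matrix.neg_apply, Matrix.mul_apply, neg_inj]
  simp only [Matrix.mul_apply, Finset.sum_mul, D', Matrix.of_apply]
  exact Finset.sum_comm

end MatrixCalculus

/-! ### Contraction with the inverse metric. -/

section InverseGram

variable {ι : Type*} [Fintype ι] [DecidableEq ι]

/-- The contraction is the trace of `(G⁻¹)ᵀ b`, in which `J` cancels by cyclicity. All chart
independence statements below rest on this identity. -/
theorem sum_inv_mul_congr_basis {G₀ G₁ J b₀ b₁ : Matrix ι ι ℝ}
    (hJ : J.det ≠ 0) (hG : G₁ = J.transpose * G₀ * J) (hb : b₁ = J.transpose * b₀ * J) :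
    ∑ i, ∑ j, G₁⁻¹ i j * b₁ i j = ∑ i, ∑ j, G₀⁻¹ i j * b₀ i j := by
  have tr : ∀ A B : Matrix ι ι ℝ, ∑ i, ∑ j, A i j * B i j = (A.transpose * B).trace := by
    intro A B
    simp only [Matrix.trace, Matrix.diag, Matrix.mul_apply, Matrix.transpose_apply]
    exact Finset.sum_comm
  have hJ' : IsUnit J.det := isUnit_iff_ne_zero.2 hJ
  have hJt : IsUnit J.transpose.det := by rwa [Matrix.det_transpose]
  rw [tr, tr, hG, hb, Matrix.mul_inv_rev, Matrix.mul_inv_rev, Matrix.transpose_mul,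
    Matrix.transpose_mul, ← Matrix.transpose_nonsing_inv, Matrix.transpose_transpose]
  have : J⁻¹ * G₀⁻¹.transpose * J⁻¹.transpose * (J.transpose * b₀ * J)
      = J⁻¹ * (G₀⁻¹.transpose * b₀ * J) := by
    rw [Matrix.transpose_nonsing_inv J]
    simp only [Matrix.mul_assoc]
    rw [← Matrix.mul_assoc (J.transpose⁻¹), Matrix.nonsing_inv_mul _ hJt, Matrix.one_mul]
  rw [this, Matrix.trace_mul_comm, Matrix.mul_assoc, Matrix.mul_nonsing_inv _ hJ', Matrix.mul_one]

/-- A substitute for an orthonormal frame: contraction with `G⁻¹` becomes a sum of inner products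
along the vectors `A a`. -/
theorem exists_inv_eq_sum_mul {G : Matrix ι ι ℝ} (hG : G.PosDef) :
    ∃ (N : ℕ) (A : Fin N → ι → ℝ), ∀ i j, G⁻¹ i j = ∑ a, A a i * A a j := by
  obtain ⟨N, A, hA⟩ := Matrix.posSemidef_iff_eq_sum_vecMulVec.1 hG.inv.posSemidef
  refine ⟨N, A, fun i j => ?_⟩
  rw [hA, Matrix.sum_apply]
  simp [Matrix.vecMulVec_apply]

end InverseGram

/-! ### Calculus of coordinate partial derivatives. -/

section PartialDerivatives

variable {m : ℕ} {V W : Type*} [NormedAddCommGroup V] [NormedSpace ℝ V]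
  [NormedAddCommGroup W] [NormedSpace ℝ W] {f h : EuclideanSpace ℝ (Fin m) → V}
  {y : EuclideanSpace ℝ (Fin m)}

theorem partialD_congr (hfh : f =ᶠ[nhds y] h) (i : Fin m) : partialD i f y = partialD i h y := by
  simp only [partialD, hfh.fderiv_eq]

theorem contDiffAt_partialD (hf : ContDiffAt ℝ ∞ f y) (i : Fin m) :
    ContDiffAt ℝ ∞ (partialD i f) y :=
  (hf.fderiv_right (m := ∞) (by simp)).clm_apply contDiffAt_const

theorem fderiv_eq_sum_partialD (f : EuclideanSpace ℝ (Fin m) → V)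
    (y v : EuclideanSpace ℝ (Fin m)) : fderiv ℝ f y v = ∑ i, v i • partialD i f y := by
  conv_lhs => rw [← (EuclideanSpace.basisFun (Fin m) ℝ).sum_repr v]
  simp [partialD]

theorem partialD_partialD (hf : ContDiffAt ℝ ∞ f y) (i j : Fin m) :
    partialD i (partialD j f) y = fderiv ℝ (fderiv ℝ f) y (EuclideanSpace.single i 1)
      (EuclideanSpace.single j 1) := by
  have h1 : DifferentiableAt ℝ (fderiv ℝ f) y :=
    (hf.fderiv_right (m := 1) (by norm_cast)).differentiableAt one_ne_zero
  have h2 := (h1.hasFDerivAt.clm_apply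
    (hasFDerivAt_const (EuclideanSpace.single j (1 : ℝ)) y)).fderiv
  change fderiv ℝ (fun z => fderiv ℝ f z (EuclideanSpace.single j 1)) y _ = _
  rw [h2]
  simp

theorem partialD_comm (hf : ContDiffAt ℝ ∞ f y) (i j : Fin m) :
    partialD i (partialD j f) y = partialD j (partialD i f) y := by
  rw [partialD_partialD hf, partialD_partialD hf]
  exact (hf.isSymmSndFDerivAt (by simp; norm_cast)).eq _ _

theorem partialD_clm (L : V →L[ℝ] W) (hf : DifferentiableAt ℝ f y) (i : Fin m) :
    partialD i (fun z => L (f z)) y = L (partialD i f y) := by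
  simp only [partialD]
  have h : HasFDerivAt (fun z => L (f z)) (L.comp (fderiv ℝ f y)) y :=
    L.hasFDerivAt.comp y hf.hasFDerivAt
  rw [h.fderiv]
  rfl

theorem _root_.ContDiffAt.differentiableAt_of_infty (hf : ContDiffAt ℝ ∞ f y) :
    DifferentiableAt ℝ f y := hf.differentiableAt (by simp)

theorem _root_.ContDiffAt.eventually_differentiableAt (hf : ContDiffAt ℝ ∞ f y) :
    ∀ᶠ z in nhds y, DifferentiableAt ℝ f z :=
  ((hf.of_le (n := ∞) (m := 1) (by norm_cast)).eventually (by simp)).mono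
    fun _ hz => hz.differentiableAt one_ne_zero

end PartialDerivatives

section InnerDerivative

variable {m : ℕ} {V : Type*} [NormedAddCommGroup V] [InnerProductSpace ℝ V]
  {f h : EuclideanSpace ℝ (Fin m) → V} {y : EuclideanSpace ℝ (Fin m)}

theorem partialD_inner (hf : DifferentiableAt ℝ f y) (hh : DifferentiableAt ℝ h y) (i : Fin m) :
    partialD i (fun z => inner ℝ (f z) (h z)) y
      = inner ℝ (f y) (partialD i h y) + inner ℝ (partialD i f y) (h y) := by
  simp only [partialD]
  exact fderiv_inner_apply ℝ hf hh _

end InnerDerivative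

/-! ### Christoffel symbols and the Laplacian of an induced metric. -/

section LocalGeometry

variable {m : ℕ} {F V : Type*} [NormedAddCommGroup F] [InnerProductSpace ℝ F]
  [NormedAddCommGroup V] [InnerProductSpace ℝ V]

/-- The Gram matrix of the partial derivatives of a parametrization. -/
def gram (Φ : EuclideanSpace ℝ (Fin m) → F) (y : EuclideanSpace ℝ (Fin m)) :
    Matrix (Fin m) (Fin m) ℝ :=
  Matrix.of fun i j => inner ℝ (partialD i Φ y) (partialD j Φ y)

/-- The Christoffel symbols of a metric given by its matrix of coefficients. -/
def chr (G : EuclideanSpace ℝ (Fin m) → Matrix (Fin m) (Fin m) ℝ) (k i j : Fin m)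
    (y : EuclideanSpace ℝ (Fin m)) : ℝ :=
  (1 / 2 : ℝ) * ∑ l : Fin m, (G y)⁻¹ k l *
    (partialD i (fun z => G z j l) y + partialD j (fun z => G z i l) y
      - partialD l (fun z => G z i j) y)

/-- The Laplace–Beltrami operator in coordinates, for functions with values in a vector space. -/
def lap {V : Type*} [NormedAddCommGroup V] [NormedSpace ℝ V]
    (G : EuclideanSpace ℝ (Fin m) → Matrix (Fin m) (Fin m) ℝ)
    (f : EuclideanSpace ℝ (Fin m) → V) (y : EuclideanSpace ℝ (Fin m)) : V :=
  ∑ i, ∑ j, (G y)⁻¹ i j •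
    (partialD i (partialD j f) y - ∑ k, chr G k i j y • partialD k f y)

/-- The pairing `g^{ij} ⟨∂_i f, ∂_j h⟩` of differentials. -/
def gradInner (G : EuclideanSpace ℝ (Fin m) → Matrix (Fin m) (Fin m) ℝ)
    (f h : EuclideanSpace ℝ (Fin m) → V) (y : EuclideanSpace ℝ (Fin m)) : ℝ :=
  ∑ i, ∑ j, (G y)⁻¹ i j * inner ℝ (partialD i f y) (partialD j h y)

variable {Φ : EuclideanSpace ℝ (Fin m) → F} {G : EuclideanSpace ℝ (Fin m) → Matrix (Fin m) (Fin m) ℝ}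
  {y : EuclideanSpace ℝ (Fin m)}

theorem gram_comm (Φ : EuclideanSpace ℝ (Fin m) → F) (y : EuclideanSpace ℝ (Fin m)) (i j : Fin m) :
    gram Φ y i j = gram Φ y j i := by
  simp [gram, real_inner_comm]

theorem inv_comm_of_symm (hG : ∀ i j, G y i j = G y j i) (i j : Fin m) :
    (G y)⁻¹ i j = (G y)⁻¹ j i := by
  have : (G y).transpose = G y := by ext i j; exact hG j i
  conv_lhs => rw [← this, ← Matrix.transpose_nonsing_inv]
  rfl

theorem contDiffAt_gram (hΦ : ContDiffAt ℝ ∞ Φ y) (i j : Fin m) :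
    ContDiffAt ℝ ∞ (fun z => gram Φ z i j) y :=
  (contDiffAt_partialD hΦ i).inner ℝ (contDiffAt_partialD hΦ j)

theorem partialD_gram (hΦ : ContDiffAt ℝ ∞ Φ y) (k i j : Fin m) :
    partialD k (fun z => gram Φ z i j) y
      = inner ℝ (partialD i Φ y) (partialD k (partialD j Φ) y)
        + inner ℝ (partialD k (partialD i Φ) y) (partialD j Φ y) :=
  partialD_inner (contDiffAt_partialD hΦ i).differentiableAt_of_infty
    (contDiffAt_partialD hΦ j).differentiableAt_of_infty k

/-- Expanding the three metric derivatives gives six terms; by symmetry of second derivatives four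
cancel and the other two coincide. -/
theorem chr_gram (hΦ : ContDiffAt ℝ ∞ Φ y) (k i j : Fin m) :
    chr (gram Φ) k i j y
      = ∑ l, (gram Φ y)⁻¹ k l * inner ℝ (partialD i (partialD j Φ) y) (partialD l Φ y) := by
  rw [chr, Finset.mul_sum]
  refine Finset.sum_congr rfl fun l _ => ?_
  rw [partialD_gram hΦ, partialD_gram hΦ, partialD_gram hΦ, partialD_comm hΦ i l,
    partialD_comm hΦ j l, partialD_comm hΦ j i, real_inner_comm (partialD l (partialD i Φ) y)]
  ring

theorem lap_clm {V W : Type*} [NormedAddCommGroup V] [NormedSpace ℝ V]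
    [NormedAddCommGroup W] [NormedSpace ℝ W] (L : V →L[ℝ] W) {f : EuclideanSpace ℝ (Fin m) → V}
    (hf : ContDiffAt ℝ ∞ f y) : lap G (fun z => L (f z)) y = L (lap G f y) := by
  simp only [lap, map_sum, map_smul, map_sub]
  have h1 : ∀ j, partialD j (fun z => L (f z)) =ᶠ[nhds y] fun z => L (partialD j f z) := fun j =>
    hf.eventually_differentiableAt.mono fun z hz => partialD_clm L hz j
  refine Finset.sum_congr rfl fun i _ => Finset.sum_congr rfl fun j _ => ?_
  rw [partialD_congr (h1 j), partialD_clm L (contDiffAt_partialD hf j).differentiableAt_of_infty]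
  simp_rw [partialD_clm L hf.differentiableAt_of_infty]

/-- The Laplacian is the divergence of the gradient. -/
theorem sum_partialD_sqrt_det_mul {f : EuclideanSpace ℝ (Fin m) → ℝ}
    (hG : ∀ i j, ContDiffAt ℝ ∞ (fun z => G z i j) y) (hsymm : ∀ z i j, G z i j = G z j i)
    (hdet : 0 < (G y).det) (hf : ContDiffAt ℝ ∞ f y) :
    ∑ i, partialD i (fun z => Real.sqrt (G z).det * ∑ j, (G z)⁻¹ i j * partialD j f z) y
      = Real.sqrt (G y).det * lap G f y := by
  have hG1 : ∀ i j, ContDiffAt ℝ 1 (fun z => G z i j) y := fun i j =>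
    (hG i j).of_le (by norm_cast)
  have hGd : ∀ i j, DifferentiableAt ℝ (fun z => G z i j) y := fun i j =>
    (hG i j).differentiableAt_of_infty
  have hdd : DifferentiableAt ℝ (fun z => (G z).det) y :=
    (contDiffAt_det hG).differentiableAt_of_infty
  have hId : ∀ i j, DifferentiableAt ℝ (fun z => (G z)⁻¹ i j) y := fun i j =>
    (contDiffAt_matrix_inv hG hdet.ne' i j).differentiableAt_of_infty
  have hpd : ∀ j, DifferentiableAt ℝ (partialD j f) y := fun j =>
    (contDiffAt_partialD hf j).differentiableAt_of_infty
  set s := Real.sqrt (G y).det with hs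
  have hspos : 0 < s := Real.sqrt_pos.2 hdet
  have hss : s * s = (G y).det := Real.mul_self_sqrt hdet.le
  set H := (G y)⁻¹ with hH
  have hHs : ∀ i j, H i j = H j i := inv_comm_of_symm (hsymm y)
  set D : Fin m → Fin m → Fin m → ℝ := fun k i j => partialD k (fun z => G z i j) y with hD
  -- The three summands come from differentiating `∂_j f`, the inverse matrix and `√det`
  -- respectively. The second will match the first two Christoffel terms (`hA`), the third the
  -- remaining one (`hB`).
  have hterm : ∀ i,
      partialD i (fun z => Real.sqrt (G z).det * ∑ j, (G z)⁻¹ i j * partialD j f z) y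
        = s * ∑ j, (H i j * partialD i (partialD j f) y
            - ∑ a, ∑ b, H i a * D i a b * H b j * partialD j f y
            + ∑ a, ∑ b, 1 / 2 * H b a * D i a b * H i j * partialD j f y) := by
    intro i
    have h1 : HasFDerivAt (fun z => ∑ j, (G z)⁻¹ i j * partialD j f z)
        (∑ j, (H i j • fderiv ℝ (partialD j f) y
          + partialD j f y • fderiv ℝ (fun z => (G z)⁻¹ i j) y)) y :=
      HasFDerivAt.fun_sum fun j _ => (hId i j).hasFDerivAt.mul (hpd j).hasFDerivAt
    have h2 : HasFDerivAt
        (fun z => Real.sqrt (G z).det * ∑ j, (G z)⁻¹ i j * partialD j f z) _ y :=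
      (hdd.hasFDerivAt.sqrt hdet.ne').mul h1
    have h3 : ∀ k v, fderiv ℝ (fun z => (G z)⁻¹ i k) y v = _ := fun k v =>
      fderiv_matrix_inv hG1 hdet.ne' i k v
    have h4 := fun v => fderiv_det hGd hdet.ne' v
    unfold partialD at h2 ⊢
    rw [h2.fderiv]
    simp only [add_apply, sum_apply, smul_apply, smul_eq_mul, h3, h4, ← hs, ← hH]
    rw [← hss]
    have h5 : ∀ x : ℝ, 1 / (2 * s) * (s * s * x) = s * (1 / 2 * x) := fun x => by
      field_simp
    rw [h5, ← mul_left_comm, ← mul_add]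
    congr 1
    rw [Finset.sum_mul, ← Finset.sum_add_distrib]
    refine Finset.sum_congr rfl fun j _ => ?_
    simp only [hD, partialD, Finset.mul_sum, mul_neg]
    rw [← sub_eq_add_neg]
    congr 1
    · congr 1
      refine Finset.sum_congr rfl fun a _ => Finset.sum_congr rfl fun b _ => ?_
      ring
    · refine Finset.sum_congr rfl fun a _ => Finset.sum_congr rfl fun b _ => ?_
      ring
  rw [Finset.sum_congr rfl fun i _ => hterm i, ← Finset.mul_sum, lap]
  congr 1
  simp only [smul_eq_mul, mul_sub, Finset.sum_sub_distrib, Finset.sum_add_distrib]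
  have hR : ∑ i, ∑ j, H i j * ∑ k, chr G k i j y * partialD k f y
      = ∑ i, ∑ j, ∑ k, ∑ l, (1 / 2 * H i j * H k l * D i j l * partialD k f y)
        + ∑ i, ∑ j, ∑ k, ∑ l, (1 / 2 * H i j * H k l * D j i l * partialD k f y)
        - ∑ i, ∑ j, ∑ k, ∑ l, (1 / 2 * H i j * H k l * D l i j * partialD k f y) := by
    simp only [← Finset.sum_sub_distrib, ← Finset.sum_add_distrib, chr, Finset.mul_sum,
      Finset.sum_mul]
    refine Finset.sum_congr rfl fun i _ => Finset.sum_congr rfl fun j _ =>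
      Finset.sum_congr rfl fun k _ => Finset.sum_congr rfl fun l _ => ?_
    simp only [hD, ← hH]
    ring
  have h12 : ∑ i, ∑ j, ∑ k, ∑ l, (1 / 2 * H i j * H k l * D j i l * partialD k f y)
      = ∑ i, ∑ j, ∑ k, ∑ l, (1 / 2 * H i j * H k l * D i j l * partialD k f y) := by
    rw [Finset.sum_comm]
    simp_rw [hHs]
  have hA : ∑ i, ∑ j, ∑ a, ∑ b, H i a * D i a b * H b j * partialD j f y
      = ∑ i, ∑ j, ∑ k, ∑ l, (1 / 2 * H i j * H k l * D i j l * partialD k f y)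
        + ∑ i, ∑ j, ∑ k, ∑ l, (1 / 2 * H i j * H k l * D i j l * partialD k f y) := by
    simp only [← Finset.sum_add_distrib]
    refine Finset.sum_congr rfl fun i _ => ?_
    rw [Finset.sum_comm]
    refine Finset.sum_congr rfl fun a _ => Finset.sum_congr rfl fun j _ =>
      Finset.sum_congr rfl fun b _ => ?_
    rw [hHs b j]
    ring
  have hB : ∑ i, ∑ j, ∑ a, ∑ b, 1 / 2 * H b a * D i a b * H i j * partialD j f y
      = ∑ i, ∑ j, ∑ k, ∑ l, (1 / 2 * H i j * H k l * D l i j * partialD k f y) := by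
    have : ∀ i, ∑ j, ∑ a, ∑ b, 1 / 2 * H b a * D i a b * H i j * partialD j f y
        = ∑ a, ∑ b, ∑ j, 1 / 2 * H a b * H j i * D i a b * partialD j f y := by
      intro i
      rw [Finset.sum_comm]
      refine Finset.sum_congr rfl fun a _ => ?_
      rw [Finset.sum_comm]
      refine Finset.sum_congr rfl fun b _ => Finset.sum_congr rfl fun j _ => ?_
      rw [hHs b a, hHs j i]
      ring
    rw [Finset.sum_congr rfl fun i _ => this i, Finset.sum_comm]
    refine Finset.sum_congr rfl fun a _ => ?_
    rw [Finset.sum_comm]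
    refine Finset.sum_congr rfl fun b _ => Finset.sum_comm
  rw [hA, hB, hR, h12]
  ring

end LocalGeometry

/-! ### Invariance of the local operators under changes of coordinates. -/

section CoordinateChange

variable {m : ℕ} {F V : Type*} [NormedAddCommGroup F] [InnerProductSpace ℝ F]
  [NormedAddCommGroup V] [InnerProductSpace ℝ V]
  {ψ : EuclideanSpace ℝ (Fin m) → EuclideanSpace ℝ (Fin m)} {y : EuclideanSpace ℝ (Fin m)}

/-- The Jacobian matrix of a map of `ℝ^m`. -/
def jac (ψ : EuclideanSpace ℝ (Fin m) → EuclideanSpace ℝ (Fin m))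
    (y : EuclideanSpace ℝ (Fin m)) : Matrix (Fin m) (Fin m) ℝ :=
  Matrix.of fun a i => partialD i ψ y a

theorem det_jac (ψ : EuclideanSpace ℝ (Fin m) → EuclideanSpace ℝ (Fin m))
    (y : EuclideanSpace ℝ (Fin m)) : (jac ψ y).det = (fderiv ℝ ψ y).det := by
  rw [ContinuousLinearMap.det, ← LinearMap.det_toMatrix (EuclideanSpace.basisFun (Fin m) ℝ).toBasis]
  congr 1

theorem partialD_comp {V : Type*} [NormedAddCommGroup V] [NormedSpace ℝ V]
    {f₀ f₁ : EuclideanSpace ℝ (Fin m) → V} (hf : f₁ =ᶠ[nhds y] f₀ ∘ ψ)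
    (h₀ : DifferentiableAt ℝ f₀ (ψ y)) (hψ : DifferentiableAt ℝ ψ y) (i : Fin m) :
    partialD i f₁ y = ∑ a, jac ψ y a i • partialD a f₀ (ψ y) := by
  rw [partialD_congr hf, partialD, fderiv_comp _ h₀ hψ, ContinuousLinearMap.comp_apply,
    fderiv_eq_sum_partialD]
  rfl

theorem gram_comp {Φ₀ Φ₁ : EuclideanSpace ℝ (Fin m) → F} (hΦ : Φ₁ =ᶠ[nhds y] Φ₀ ∘ ψ)
    (h₀ : DifferentiableAt ℝ Φ₀ (ψ y)) (hψ : DifferentiableAt ℝ ψ y) :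
    gram Φ₁ y = (jac ψ y).transpose * gram Φ₀ (ψ y) * jac ψ y := by
  ext i j
  simp only [gram, Matrix.of_apply, partialD_comp hΦ h₀ hψ, sum_inner, inner_sum,
    inner_smul_left, inner_smul_right, Matrix.mul_apply, Matrix.transpose_apply, Finset.sum_mul,
    Finset.mul_sum]
  refine Finset.sum_congr rfl fun a _ => Finset.sum_congr rfl fun b _ => ?_
  simp only [conj_trivial]
  ring

theorem gradInner_comp {Φ₀ Φ₁ : EuclideanSpace ℝ (Fin m) → F}
    {f₀ f₁ h₀ h₁ : EuclideanSpace ℝ (Fin m) → V} (hΦ : Φ₁ =ᶠ[nhds y] Φ₀ ∘ ψ)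
    (hf : f₁ =ᶠ[nhds y] f₀ ∘ ψ) (hh : h₁ =ᶠ[nhds y] h₀ ∘ ψ)
    (dΦ : DifferentiableAt ℝ Φ₀ (ψ y)) (df : DifferentiableAt ℝ f₀ (ψ y))
    (dh : DifferentiableAt ℝ h₀ (ψ y)) (hψ : DifferentiableAt ℝ ψ y) (hJ : (jac ψ y).det ≠ 0) :
    gradInner (gram Φ₁) f₁ h₁ y = gradInner (gram Φ₀) f₀ h₀ (ψ y) := by
  refine sum_inv_mul_congr_basis
    (b₁ := Matrix.of fun i j => inner ℝ (partialD i f₁ y) (partialD j h₁ y))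
    (b₀ := Matrix.of fun i j => inner ℝ (partialD i f₀ (ψ y)) (partialD j h₀ (ψ y)))
    hJ (gram_comp hΦ dΦ hψ) ?_
  ext i j
  simp only [Matrix.of_apply, partialD_comp hf df hψ, partialD_comp hh dh hψ, sum_inner, inner_sum,
    inner_smul_left, inner_smul_right, Matrix.mul_apply, Matrix.transpose_apply, Finset.sum_mul,
    Finset.mul_sum]
  refine Finset.sum_congr rfl fun a _ => Finset.sum_congr rfl fun b _ => ?_
  simp only [conj_trivial]
  ring

/-- At a critical point the second derivatives transform as a bilinear form. -/
theorem partialD_partialD_comp_of_critical {f₀ f₁ : EuclideanSpace ℝ (Fin m) → ℝ}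
    (hf : f₁ =ᶠ[nhds y] f₀ ∘ ψ) (h₀ : ContDiffAt ℝ ∞ f₀ (ψ y)) (hψ : ContDiffAt ℝ ∞ ψ y)
    (hcrit : ∀ a, partialD a f₀ (ψ y) = 0) (i j : Fin m) :
    partialD i (partialD j f₁) y
      = ∑ a, ∑ b, jac ψ y a i * jac ψ y b j * partialD a (partialD b f₀) (ψ y) := by
  have hψc := hψ.continuousAt
  have e1 : partialD j f₁ =ᶠ[nhds y] fun z => ∑ b, jac ψ z b j * partialD b f₀ (ψ z) := by
    filter_upwards [hf.eventuallyEq_nhds, hψc.eventually h₀.eventually_differentiableAt,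
      hψ.eventually_differentiableAt] with z h1 h2 h3
    rw [partialD_comp h1 h2 h3]
    rfl
  have hJd : ∀ b, DifferentiableAt ℝ (fun z => jac ψ z b j) y := fun b =>
    ((EuclideanSpace.proj (𝕜 := ℝ) b).differentiableAt.comp y
      (contDiffAt_partialD hψ j).differentiableAt_of_infty)
  have hpd : ∀ b, DifferentiableAt ℝ (fun z => partialD b f₀ (ψ z)) y := fun b =>
    (contDiffAt_partialD h₀ b).differentiableAt_of_infty.comp y hψ.differentiableAt_of_infty
  have e2 : HasFDerivAt (fun z => ∑ b, jac ψ z b j * partialD b f₀ (ψ z)) (∑ b,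
      (jac ψ y b j • fderiv ℝ (fun z => partialD b f₀ (ψ z)) y
        + partialD b f₀ (ψ y) • fderiv ℝ (fun z => jac ψ z b j) y)) y :=
    HasFDerivAt.fun_sum fun b _ => (hJd b).hasFDerivAt.mul (hpd b).hasFDerivAt
  rw [partialD_congr e1, partialD, e2.fderiv]
  simp only [hcrit, zero_smul, add_zero, sum_apply, smul_apply, smul_eq_mul]
  rw [Finset.sum_comm]
  refine Finset.sum_congr rfl fun b _ => ?_
  have e3 := partialD_comp (f₁ := fun z => partialD b f₀ (ψ z)) Filter.EventuallyEq.rfl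
    (contDiffAt_partialD h₀ b).differentiableAt_of_infty hψ.differentiableAt_of_infty i
  rw [partialD] at e3
  rw [e3, Finset.mul_sum]
  exact Finset.sum_congr rfl fun a _ => by simp only [smul_eq_mul]; ring

/-- The gradient of `f`, pushed forward by the parametrization `Φ`. -/
def pushGrad (Φ : EuclideanSpace ℝ (Fin m) → F) (f : EuclideanSpace ℝ (Fin m) → ℝ)
    (y : EuclideanSpace ℝ (Fin m)) : F :=
  ∑ k, ∑ l, ((gram Φ y)⁻¹ k l * partialD k f y) • partialD l Φ y

/-- For `v = ∂_i ∂_j Φ` the right-hand side is the Christoffel term `Γ^k_ij ∂_k f`, by `chr_gram`.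
-/
theorem inner_pushGrad {Φ : EuclideanSpace ℝ (Fin m) → F} {f : EuclideanSpace ℝ (Fin m) → ℝ}
    (v : F) : inner ℝ v (pushGrad Φ f y)
      = ∑ k, (∑ l, (gram Φ y)⁻¹ k l * inner ℝ v (partialD l Φ y)) * partialD k f y := by
  simp only [pushGrad, inner_sum, inner_smul_right, Finset.sum_mul]
  exact Finset.sum_congr rfl fun k _ => Finset.sum_congr rfl fun l _ => by ring

theorem partialD_sub_inner {Φ : EuclideanSpace ℝ (Fin m) → F} {f : EuclideanSpace ℝ (Fin m) → ℝ}
    (hΦ : DifferentiableAt ℝ Φ y) (hf : DifferentiableAt ℝ f y) (w : F) (i : Fin m) :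
    partialD i (fun z => f z - inner ℝ (Φ z) w) y = partialD i f y - inner ℝ (partialD i Φ y) w := by
  have h1 := partialD_inner hΦ (differentiableAt_const w) i
  have h2 : partialD i (fun _ : EuclideanSpace ℝ (Fin m) => w) y = 0 := by simp [partialD]
  rw [h2, inner_zero_right, zero_add] at h1
  rw [← h1, partialD, fderiv_fun_sub hf (hΦ.inner ℝ (differentiableAt_const w))]
  rfl

/-- The pushed-forward gradient `W`, frozen at `y`, satisfies `⟨∂_i Φ, W⟩ = ∂_i f`. Subtracting `⟨Φ,
W⟩` thus creates a critical point at `y`. -/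
theorem partialD_sub_inner_pushGrad {Φ : EuclideanSpace ℝ (Fin m) → F}
    {f : EuclideanSpace ℝ (Fin m) → ℝ} (hΦ : DifferentiableAt ℝ Φ y) (hf : DifferentiableAt ℝ f y)
    (hdet : (gram Φ y).det ≠ 0) (i : Fin m) :
    partialD i (fun z => f z - inner ℝ (Φ z) (pushGrad Φ f y)) y = 0 := by
  rw [partialD_sub_inner hΦ hf, inner_pushGrad]
  have : ∀ k, ∑ l, (gram Φ y)⁻¹ k l * inner ℝ (partialD i Φ y) (partialD l Φ y)
      = (1 : Matrix (Fin m) (Fin m) ℝ) k i := by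
    intro k
    rw [← Matrix.nonsing_inv_mul (gram Φ y) (isUnit_iff_ne_zero.2 hdet), Matrix.mul_apply]
    exact Finset.sum_congr rfl fun l _ => by rw [gram_comm]; rfl
  simp [this, Matrix.one_apply]

/-- The Laplacian as the trace of the Hessian of a function with a critical point. -/
theorem lap_eq_sum_partialD_partialD {Φ : EuclideanSpace ℝ (Fin m) → F}
    {f : EuclideanSpace ℝ (Fin m) → ℝ} (hΦ : ContDiffAt ℝ ∞ Φ y) (hf : ContDiffAt ℝ ∞ f y) :
    lap (gram Φ) f y = ∑ i, ∑ j, (gram Φ y)⁻¹ i j *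
      partialD i (partialD j (fun z => f z - inner ℝ (Φ z) (pushGrad Φ f y))) y := by
  refine Finset.sum_congr rfl fun i _ => Finset.sum_congr rfl fun j _ => ?_
  have e1 : partialD j (fun z => f z - inner ℝ (Φ z) (pushGrad Φ f y)) =ᶠ[nhds y]
      fun z => partialD j f z - inner ℝ (partialD j Φ z) (pushGrad Φ f y) := by
    filter_upwards [hf.eventually_differentiableAt, hΦ.eventually_differentiableAt] with z h1 h2
    exact partialD_sub_inner h2 h1 _ _
  rw [partialD_congr e1, partialD_sub_inner (contDiffAt_partialD hΦ j).differentiableAt_of_infty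
    (contDiffAt_partialD hf j).differentiableAt_of_infty, inner_pushGrad]
  simp only [chr_gram hΦ, smul_eq_mul]

/-- The transformation law of Christoffel symbols is avoided: the Laplacian is the trace of the
plain second derivatives of `f - ⟨Φ, W⟩`, and at a critical point these form a bilinear form. -/
theorem lap_comp_real {Φ₀ Φ₁ : EuclideanSpace ℝ (Fin m) → F}
    {f₀ f₁ : EuclideanSpace ℝ (Fin m) → ℝ} (hΦ : Φ₁ =ᶠ[nhds y] Φ₀ ∘ ψ) (hf : f₁ =ᶠ[nhds y] f₀ ∘ ψ)
    (dΦ : ContDiffAt ℝ ∞ Φ₀ (ψ y)) (df : ContDiffAt ℝ ∞ f₀ (ψ y)) (hψ : ContDiffAt ℝ ∞ ψ y)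
    (hJ : (jac ψ y).det ≠ 0) (hdet : (gram Φ₀ (ψ y)).det ≠ 0) :
    lap (gram Φ₁) f₁ y = lap (gram Φ₀) f₀ (ψ y) := by
  have dΦ' := dΦ.differentiableAt_of_infty
  have df' := df.differentiableAt_of_infty
  have dψ' := hψ.differentiableAt_of_infty
  have hG := gram_comp hΦ dΦ' dψ'
  -- Both charts yield the same vector of `F`, so the two corrected functions correspond under `ψ`.
  have hW : pushGrad Φ₁ f₁ y = pushGrad Φ₀ f₀ (ψ y) := by
    refine ext_inner_left ℝ fun v => ?_
    have e : ∀ (Φ : EuclideanSpace ℝ (Fin m) → F) (f : EuclideanSpace ℝ (Fin m) → ℝ)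
        (z : EuclideanSpace ℝ (Fin m)), inner ℝ v (pushGrad Φ f z)
          = ∑ i, ∑ j, (gram Φ z)⁻¹ i j *
            (Matrix.of fun i j => partialD i f z * inner ℝ v (partialD j Φ z)) i j := by
      intro Φ f z
      rw [inner_pushGrad]
      simp only [Finset.sum_mul, Matrix.of_apply]
      exact Finset.sum_congr rfl fun k _ => Finset.sum_congr rfl fun l _ => by ring
    rw [e, e]
    refine sum_inv_mul_congr_basis hJ hG ?_
    ext i j
    simp only [Matrix.of_apply, partialD_comp hΦ dΦ' dψ', partialD_comp hf df' dψ', inner_sum,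
      inner_smul_right, Matrix.mul_apply, Matrix.transpose_apply, Finset.sum_mul, Finset.mul_sum,
      smul_eq_mul]
    refine Finset.sum_congr rfl fun a _ => Finset.sum_congr rfl fun b _ => ?_
    ring
  have c₀ : ContDiffAt ℝ ∞ (fun z => f₀ z - inner ℝ (Φ₀ z) (pushGrad Φ₀ f₀ (ψ y))) (ψ y) :=
    df.sub (dΦ.inner ℝ contDiffAt_const)
  have dΦ₁ : ContDiffAt ℝ ∞ Φ₁ y := (dΦ.comp y hψ).congr_of_eventuallyEq hΦ
  have df₁ : ContDiffAt ℝ ∞ f₁ y := (df.comp y hψ).congr_of_eventuallyEq hf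
  have key : (fun z => f₁ z - inner ℝ (Φ₁ z) (pushGrad Φ₁ f₁ y)) =ᶠ[nhds y]
      (fun z => f₀ z - inner ℝ (Φ₀ z) (pushGrad Φ₀ f₀ (ψ y))) ∘ ψ := by
    filter_upwards [hΦ, hf] with z h1 h2
    rw [h1, h2, hW]
    rfl
  rw [lap_eq_sum_partialD_partialD dΦ₁ df₁, lap_eq_sum_partialD_partialD dΦ df]
  refine sum_inv_mul_congr_basis
    (b₁ := Matrix.of fun i j => partialD i (partialD j _) y)
    (b₀ := Matrix.of fun i j => partialD i (partialD j _) (ψ y)) hJ hG ?_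
  ext i j
  simp only [Matrix.of_apply, Matrix.mul_apply, Matrix.transpose_apply, Finset.sum_mul,
    partialD_partialD_comp_of_critical key c₀ hψ
      (fun a => partialD_sub_inner_pushGrad dΦ' df' hdet a)]
  rw [Finset.sum_comm]
  exact Finset.sum_congr rfl fun a _ => Finset.sum_congr rfl fun b _ => by ring

theorem lap_comp {Φ₀ Φ₁ : EuclideanSpace ℝ (Fin m) → F}
    {f₀ f₁ : EuclideanSpace ℝ (Fin m) → V} (hΦ : Φ₁ =ᶠ[nhds y] Φ₀ ∘ ψ) (hf : f₁ =ᶠ[nhds y] f₀ ∘ ψ)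
    (dΦ : ContDiffAt ℝ ∞ Φ₀ (ψ y)) (df : ContDiffAt ℝ ∞ f₀ (ψ y)) (hψ : ContDiffAt ℝ ∞ ψ y)
    (hJ : (jac ψ y).det ≠ 0) (hdet : (gram Φ₀ (ψ y)).det ≠ 0) :
    lap (gram Φ₁) f₁ y = lap (gram Φ₀) f₀ (ψ y) := by
  refine ext_inner_left ℝ fun v => ?_
  have df₁ : ContDiffAt ℝ ∞ f₁ y := (df.comp y hψ).congr_of_eventuallyEq hf
  rw [← innerSL_apply_apply ℝ v, ← innerSL_apply_apply ℝ v, ← lap_clm _ df₁, ← lap_clm _ df]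
  refine lap_comp_real hΦ ?_ dΦ (contDiffAt_const.clm_apply df) hψ hJ hdet
  filter_upwards [hf] with z hz
  rw [hz]
  rfl

end CoordinateChange

/-! ### Bochner-type identities and Cauchy–Schwarz estimates. -/

section Identities

variable {m : ℕ} {F V : Type*} [NormedAddCommGroup F] [InnerProductSpace ℝ F]
  [NormedAddCommGroup V] [InnerProductSpace ℝ V]
  {Φ : EuclideanSpace ℝ (Fin m) → F} {G : EuclideanSpace ℝ (Fin m) → Matrix (Fin m) (Fin m) ℝ}
  {y : EuclideanSpace ℝ (Fin m)}

/-- `Γ^k_ij ∂_k Φ` is the tangential part of `∂_i ∂_j Φ`, so the Hessian of an isometric immersion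
is normal, entry by entry. -/
theorem inner_lap_partialD (hΦ : ContDiffAt ℝ ∞ Φ y) (hdet : (gram Φ y).det ≠ 0) (l : Fin m) :
    inner ℝ (lap (gram Φ) Φ y) (partialD l Φ y) = 0 := by
  simp only [lap, sum_inner, inner_smul_left, inner_sub_left, chr_gram hΦ]
  refine Finset.sum_eq_zero fun i _ => Finset.sum_eq_zero fun j _ => ?_
  have h1 : ∀ p, ∑ k, (gram Φ y)⁻¹ k p * inner ℝ (partialD k Φ y) (partialD l Φ y)
      = (1 : Matrix (Fin m) (Fin m) ℝ) p l := by
    intro p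
    rw [← Matrix.nonsing_inv_mul (gram Φ y) (isUnit_iff_ne_zero.2 hdet), Matrix.mul_apply]
    exact Finset.sum_congr rfl fun k _ => by rw [inv_comm_of_symm (gram_comm Φ y)]; rfl
  have h2 : ∑ k, (∑ p, (gram Φ y)⁻¹ k p * inner ℝ (partialD i (partialD j Φ) y) (partialD p Φ y))
      * inner ℝ (partialD k Φ y) (partialD l Φ y)
      = inner ℝ (partialD i (partialD j Φ) y) (partialD l Φ y) := by
    calc _ = ∑ p, inner ℝ (partialD i (partialD j Φ) y) (partialD p Φ y) *
          ∑ k, (gram Φ y)⁻¹ k p * inner ℝ (partialD k Φ y) (partialD l Φ y) := by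
          simp only [Finset.sum_mul, Finset.mul_sum]
          rw [Finset.sum_comm]
          exact Finset.sum_congr rfl fun p _ => Finset.sum_congr rfl fun k _ => by ring
      _ = _ := by simp [h1, Matrix.one_apply]
  simp only [conj_trivial, h2, sub_self, mul_zero]

theorem lap_inner_self {f : EuclideanSpace ℝ (Fin m) → V} (hf : ContDiffAt ℝ ∞ f y) :
    lap G (fun z => inner ℝ (f z) (f z)) y
      = 2 * inner ℝ (lap G f y) (f y) + 2 * gradInner G f f y := by
  have d0 := hf.differentiableAt_of_infty
  have e1 : ∀ j, partialD j (fun z => inner ℝ (f z) (f z)) =ᶠ[nhds y]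
      fun z => 2 * inner ℝ (partialD j f z) (f z) := by
    intro j
    filter_upwards [hf.eventually_differentiableAt] with z hz
    rw [partialD_inner hz hz, real_inner_comm]
    ring
  have e2 : ∀ i j, partialD i (partialD j (fun z => inner ℝ (f z) (f z))) y
      = 2 * inner ℝ (partialD i (partialD j f) y) (f y)
        + 2 * inner ℝ (partialD i f y) (partialD j f y) := by
    intro i j
    have d1 := (contDiffAt_partialD hf j).differentiableAt_of_infty
    have h := partialD_inner d1 d0 i
    have h2 := partialD_clm ((2 : ℝ) • ContinuousLinearMap.id ℝ ℝ) (d1.inner ℝ d0) i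
    rw [partialD_congr (e1 j)]
    refine h2.trans ?_
    simp only [smul_apply, ContinuousLinearMap.id_apply, smul_eq_mul]
    rw [h, real_inner_comm (partialD j f y)]
    ring
  simp only [lap, gradInner, e2, (e1 _).eq_of_nhds, sum_inner, inner_smul_left, inner_sub_left,
    Finset.mul_sum, ← Finset.sum_add_distrib]
  refine Finset.sum_congr rfl fun i _ => Finset.sum_congr rfl fun j _ => ?_
  have : ∑ k, chr G k i j y * (2 * inner ℝ (partialD k f y) (f y))
      = 2 * ∑ k, chr G k i j y * inner ℝ (partialD k f y) (f y) := by
    rw [Finset.mul_sum]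
    exact Finset.sum_congr rfl fun k _ => by ring
  simp only [smul_eq_mul, conj_trivial, this]
  ring

/-- If `T` is orthogonal to the image of `dΦ`, then `g^{ij} ⟨∂_i T, ∂_j Φ⟩ = -⟨T, Δ Φ⟩`. -/
theorem gradInner_eq_neg_inner_lap {T : EuclideanSpace ℝ (Fin m) → F} (hΦ : ContDiffAt ℝ ∞ Φ y)
    (hT : DifferentiableAt ℝ T y)
    (horth : ∀ᶠ z in nhds y, ∀ j, inner ℝ (T z) (partialD j Φ z) = 0) :
    gradInner G T Φ y = -inner ℝ (T y) (lap G Φ y) := by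
  rw [eq_neg_iff_add_eq_zero]
  simp only [gradInner, lap, inner_sum, inner_smul_right, inner_sub_right, horth.self_of_nhds,
    mul_zero, Finset.sum_const_zero, sub_zero, ← Finset.sum_add_distrib, ← mul_add]
  refine Finset.sum_eq_zero fun i _ => Finset.sum_eq_zero fun j _ => ?_
  have h1 := partialD_inner hT (contDiffAt_partialD hΦ j).differentiableAt_of_infty i
  have h2 : (fun z => inner ℝ (T z) (partialD j Φ z)) =ᶠ[nhds y] fun _ => (0 : ℝ) :=
    horth.mono fun z hz => hz j
  rw [partialD_congr h2] at h1
  have h3 : partialD i (fun _ : EuclideanSpace ℝ (Fin m) => (0 : ℝ)) y = 0 := by simp [partialD]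
  rw [h3] at h1
  rw [add_comm, ← h1, mul_zero]

/-- The pairing of differentials is a sum of inner products of derivatives along a frame. -/
theorem gradInner_eq_sum_inner {N : ℕ} {A : Fin N → Fin m → ℝ}
    (hA : ∀ i j, (G y)⁻¹ i j = ∑ a, A a i * A a j) (f h : EuclideanSpace ℝ (Fin m) → V) :
    gradInner G f h y
      = ∑ a, inner ℝ (∑ i, A a i • partialD i f y) (∑ j, A a j • partialD j h y) := by
  simp only [gradInner, hA, sum_inner, inner_sum, inner_smul_left, inner_smul_right, conj_trivial,
    Finset.sum_mul, Finset.mul_sum]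
  rw [Finset.sum_comm (s := (Finset.univ : Finset (Fin N)))]
  rw [Finset.sum_comm]
  refine Finset.sum_congr rfl fun j _ => ?_
  rw [Finset.sum_comm (s := (Finset.univ : Finset (Fin N)))]
  exact Finset.sum_congr rfl fun i _ => Finset.sum_congr rfl fun a _ => by ring

theorem gradInner_self_nonneg (hG : (G y).PosDef) (f : EuclideanSpace ℝ (Fin m) → V) :
    0 ≤ gradInner G f f y := by
  obtain ⟨N, A, hA⟩ := exists_inv_eq_sum_mul hG
  rw [gradInner_eq_sum_inner hA]
  exact Finset.sum_nonneg fun a _ => real_inner_self_nonneg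

theorem partialD_eq_zero_of_gradInner_self (hG : (G y).PosDef)
    {f : EuclideanSpace ℝ (Fin m) → V} (h0 : gradInner G f f y = 0) (i : Fin m) :
    partialD i f y = 0 := by
  obtain ⟨N, A, hA⟩ := exists_inv_eq_sum_mul hG
  rw [gradInner_eq_sum_inner hA, Finset.sum_eq_zero_iff_of_nonneg fun a _ => real_inner_self_nonneg] at h0
  have h1 : ∀ a, ∑ i, A a i • partialD i f y = 0 := fun a =>
    inner_self_eq_zero.1 (h0 a (Finset.mem_univ a))
  have h2 : ∀ k, ∑ j, (G y)⁻¹ k j • partialD j f y = 0 := by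
    intro k
    have : ∑ j, (G y)⁻¹ k j • partialD j f y = ∑ a, A a k • ∑ j, A a j • partialD j f y := by
      simp only [hA, Finset.sum_smul, Finset.smul_sum, mul_smul]
      exact Finset.sum_comm
    simp [this, h1]
  have h3 : ∑ k, G y i k • ∑ j, (G y)⁻¹ k j • partialD j f y = partialD i f y := by
    have : ∀ j, ∑ k, G y i k * (G y)⁻¹ k j = (1 : Matrix (Fin m) (Fin m) ℝ) i j := fun j => by
      rw [← Matrix.mul_nonsing_inv (G y) (isUnit_iff_ne_zero.2 hG.det_pos.ne'), Matrix.mul_apply]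
    simp only [Finset.smul_sum, smul_smul]
    rw [Finset.sum_comm]
    simp only [← Finset.sum_smul, this]
    simp [Matrix.one_apply]
  rw [← h3]
  simp [h2]

/-- The derivative of `|f|²` along each frame vector is `2⟨f, ∂f⟩`; Cauchy–Schwarz is applied to
each one separately. -/
theorem gradInner_inner_self_le (hG : (G y).PosDef) {f : EuclideanSpace ℝ (Fin m) → V}
    (hf : DifferentiableAt ℝ f y) :
    gradInner G (fun z => inner ℝ (f z) (f z)) (fun z => inner ℝ (f z) (f z)) y
      ≤ 4 * inner ℝ (f y) (f y) * gradInner G f f y := by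
  obtain ⟨N, A, hA⟩ := exists_inv_eq_sum_mul hG
  rw [gradInner_eq_sum_inner hA, gradInner_eq_sum_inner hA, Finset.mul_sum]
  refine Finset.sum_le_sum fun a _ => ?_
  have h1 : ∑ i, A a i • partialD i (fun z => inner ℝ (f z) (f z)) y
      = 2 * inner ℝ (f y) (∑ i, A a i • partialD i f y) := by
    simp only [inner_sum, inner_smul_right, Finset.mul_sum]
    refine Finset.sum_congr rfl fun i _ => ?_
    rw [partialD_inner hf hf, real_inner_comm (f y), smul_eq_mul]
    ring
  rw [h1]
  have h2 := real_inner_mul_inner_self_le (f y) (∑ i, A a i • partialD i f y)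
  have h3 : inner ℝ (2 * inner ℝ (f y) (∑ i, A a i • partialD i f y))
      (2 * inner ℝ (f y) (∑ i, A a i • partialD i f y))
      = 4 * (inner ℝ (f y) (∑ i, A a i • partialD i f y)
        * inner ℝ (f y) (∑ i, A a i • partialD i f y)) := by
    simp only [RCLike.inner_apply, conj_trivial]
    ring
  rw [h3]
  linarith

/-- A covector bounded by `L` on vectors pairs with `du` at most as `L |du|`. -/
theorem abs_sum_inv_gram_mul_le {u : EuclideanSpace ℝ (Fin m) → ℝ}
    (hdet : (gram Φ y).det ≠ 0) {D : EuclideanSpace ℝ (Fin m) →L[ℝ] ℝ} {L : ℝ}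
    (hD : ∀ v, |D v| ≤ L * ‖fderiv ℝ Φ y v‖) :
    |∑ i, (∑ j, (gram Φ y)⁻¹ i j * partialD j u y) * D (EuclideanSpace.single i 1)|
      ≤ L * Real.sqrt (gradInner (gram Φ) u u y) := by
  -- The components of the gradient of `u`. The vector `v` built from them satisfies `|dΦ v|² =
  -- |du|²`, and the claim is `hD` at `v`.
  set c : Fin m → ℝ := fun i => ∑ j, (gram Φ y)⁻¹ i j * partialD j u y with hc
  set v : EuclideanSpace ℝ (Fin m) := ∑ i, c i • EuclideanSpace.single i (1 : ℝ) with hv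
  have h1 : D v = ∑ i, c i * D (EuclideanSpace.single i 1) := by simp [hv]
  have h2 : ∀ k, inner ℝ (partialD k Φ y) (fderiv ℝ Φ y v) = partialD k u y := by
    intro k
    have e1 : inner ℝ (partialD k Φ y) (fderiv ℝ Φ y v)
        = ∑ i, gram Φ y k i * c i := by
      simp only [hv, map_sum, map_smul, inner_sum, inner_smul_right]
      exact Finset.sum_congr rfl fun i _ => mul_comm _ _
    have e2 : ∀ j, ∑ i, gram Φ y k i * (gram Φ y)⁻¹ i j = (1 : Matrix (Fin m) (Fin m) ℝ) k j :=
      fun j => by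
        rw [← Matrix.mul_nonsing_inv (gram Φ y) (isUnit_iff_ne_zero.2 hdet), Matrix.mul_apply]
    rw [e1]
    simp only [hc, Finset.mul_sum, ← mul_assoc]
    rw [Finset.sum_comm]
    simp only [← Finset.sum_mul, e2]
    simp [Matrix.one_apply]
  have h3 : ‖fderiv ℝ Φ y v‖ ^ 2 = gradInner (gram Φ) u u y := by
    have e1 : fderiv ℝ Φ y v = ∑ i, c i • partialD i Φ y := by
      simp only [hv, map_sum, map_smul, partialD]
    rw [← real_inner_self_eq_norm_sq]
    nth_rw 1 [e1]
    simp only [sum_inner, inner_smul_left, h2, conj_trivial, gradInner, hc, Finset.sum_mul]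
    refine Finset.sum_congr rfl fun i _ => Finset.sum_congr rfl fun j _ => ?_
    simp only [RCLike.inner_apply, conj_trivial]
    ring
  rw [← h1, ← h3, Real.sqrt_sq (norm_nonneg _)]
  exact hD v

end Identities

/-! ### Charts and transition maps. -/

section Charts

variable {m : ℕ} {M : Type*} [TopologicalSpace M] [ChartedSpace (EuclideanSpace ℝ (Fin m)) M]
  {V : Type*} [NormedAddCommGroup V] [NormedSpace ℝ V] {x₀ : M}
  {y : EuclideanSpace ℝ (Fin m)}

/-- The change of coordinates from the chart at `x₁` to the chart at `x₀`. -/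
def transition (m : ℕ) {M : Type*} [TopologicalSpace M] [ChartedSpace (EuclideanSpace ℝ (Fin m)) M]
    (x₀ x₁ : M) : EuclideanSpace ℝ (Fin m) → EuclideanSpace ℝ (Fin m) :=
  extChartAt (𝓡 m) x₀ ∘ param m x₁

theorem param_transition {x₁ : M} (hy₀ : param m x₁ y ∈ (extChartAt (𝓡 m) x₀).source) :
    param m x₀ (transition m x₀ x₁ y) = param m x₁ y :=
  (extChartAt (𝓡 m) x₀).left_inv hy₀

theorem transition_mem {x₁ : M} (hy₀ : param m x₁ y ∈ (extChartAt (𝓡 m) x₀).source) :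
    transition m x₀ x₁ y ∈ (extChartAt (𝓡 m) x₀).target :=
  (extChartAt (𝓡 m) x₀).map_source hy₀

theorem param_extChartAt_self (p : M) : param m p (extChartAt (𝓡 m) p p) = p :=
  extChartAt_to_inv p

variable [IsManifold (𝓡 m) ∞ M]

theorem contMDiffAt_param (hy : y ∈ (extChartAt (𝓡 m) x₀).target) :
    ContMDiffAt (𝓡 m) (𝓡 m) ∞ (param m x₀) y :=
  (contMDiffOn_extChartAt_symm x₀).contMDiffAt ((isOpen_extChartAt_target x₀).mem_nhds hy)

theorem mdifferentiableAt_param (hy : y ∈ (extChartAt (𝓡 m) x₀).target) :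
    MDifferentiableAt (𝓡 m) (𝓡 m) (param m x₀) y :=
  (contMDiffAt_param hy).mdifferentiableAt (by simp)

theorem contDiffAt_comp_param {f : M → V} (hf : ContMDiff (𝓡 m) 𝓘(ℝ, V) ∞ f)
    (hy : y ∈ (extChartAt (𝓡 m) x₀).target) : ContDiffAt ℝ ∞ (f ∘ param m x₀) y :=
  contMDiffAt_iff_contDiffAt.1 ((hf _).comp y (contMDiffAt_param hy))

theorem mvfderiv_mfderiv_param {f : M → V} (hf : ContMDiff (𝓡 m) 𝓘(ℝ, V) ∞ f)
    (hy : y ∈ (extChartAt (𝓡 m) x₀).target) (v : EuclideanSpace ℝ (Fin m)) :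
    mvfderiv (𝓡 m) f (param m x₀ y) (mfderiv (𝓡 m) (𝓡 m) (param m x₀) y v)
      = fderiv ℝ (f ∘ param m x₀) y v := by
  have h := mfderiv_comp_apply (I := 𝓡 m) (I' := 𝓡 m) (I'' := 𝓘(ℝ, V)) (f := param m x₀) y
    ((hf (param m x₀ y)).mdifferentiableAt (by simp)) (mdifferentiableAt_param hy) v
  refine h.symm.trans ?_
  change mfderiv (𝓡 m) 𝓘(ℝ, V) (f ∘ param m x₀) y v = _
  rw [mfderiv_eq_fderiv]
  rfl

theorem injective_mfderiv_param (hy : y ∈ (extChartAt (𝓡 m) x₀).target) :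
    Function.Injective (mfderiv (𝓡 m) (𝓡 m) (param m x₀) y) := by
  have h := isInvertible_mfderivWithin_extChartAt_symm (I := 𝓡 m) hy
  rw [ModelWithCorners.range_eq_univ, mfderivWithin_univ] at h
  exact h.injective

theorem contDiffAt_transition {x₁ : M} (hy : y ∈ (extChartAt (𝓡 m) x₁).target)
    (hy₀ : param m x₁ y ∈ (extChartAt (𝓡 m) x₀).source) :
    ContDiffAt ℝ ∞ (transition m x₀ x₁) y := by
  rw [extChartAt_source] at hy₀
  exact contMDiffAt_iff_contDiffAt.1
    ((contMDiffAt_extChartAt' hy₀).comp y (contMDiffAt_param hy))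

theorem comp_param_eventuallyEq {x₁ : M} {W : Type*} (f : M → W)
    (hy : y ∈ (extChartAt (𝓡 m) x₁).target) (hy₀ : param m x₁ y ∈ (extChartAt (𝓡 m) x₀).source) :
    f ∘ param m x₁ =ᶠ[nhds y] (f ∘ param m x₀) ∘ transition m x₀ x₁ := by
  have h1 : ∀ᶠ z in nhds y, param m x₁ z ∈ (extChartAt (𝓡 m) x₀).source :=
    (contMDiffAt_param hy).continuousAt.eventually
      ((isOpen_extChartAt_source x₀).mem_nhds hy₀)
  filter_upwards [h1] with z hz
  simp only [Function.comp_apply, param_transition hz]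

end Charts

/-! ### The immersion in charts and the operators it induces on the manifold. -/

section Immersion

variable {m n : ℕ} {r : ℝ} {M : Type*} [TopologicalSpace M]
  [ChartedSpace (EuclideanSpace ℝ (Fin m)) M] [IsManifold (𝓡 m) ∞ M]
  {φ : M → Metric.sphere (0 : EuclideanSpace ℝ (Fin (n + 1))) r} {x₀ : M}
  {y : EuclideanSpace ℝ (Fin m)}

/-- The immersion into the ambient Euclidean space, in the chart at `x₀`. -/
def localImm (m : ℕ) {M : Type*} [TopologicalSpace M]
    [ChartedSpace (EuclideanSpace ℝ (Fin m)) M]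
    (φ : M → Metric.sphere (0 : EuclideanSpace ℝ (Fin (n + 1))) r) (x₀ : M) :
    EuclideanSpace ℝ (Fin m) → EuclideanSpace ℝ (Fin (n + 1)) :=
  incl φ ∘ param m x₀

theorem localImm_eventuallyEq {x₁ : M} (hy : y ∈ (extChartAt (𝓡 m) x₁).target)
    (hy₀ : param m x₁ y ∈ (extChartAt (𝓡 m) x₀).source) :
    localImm m φ x₁ =ᶠ[nhds y] localImm m φ x₀ ∘ transition m x₀ x₁ :=
  comp_param_eventuallyEq _ hy hy₀

variable [RiemannianBundle (fun x : M => TangentSpace (𝓡 m) x)]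

theorem contDiffAt_localImm (hφ : IsSmoothIsometricImmersion m φ)
    (hy : y ∈ (extChartAt (𝓡 m) x₀).target) : ContDiffAt ℝ ∞ (localImm m φ x₀) y :=
  contDiffAt_comp_param hφ.smooth hy

theorem contDiffAt_gram_localImm (hφ : IsSmoothIsometricImmersion m φ)
    (hy : y ∈ (extChartAt (𝓡 m) x₀).target) (i j : Fin m) :
    ContDiffAt ℝ ∞ (fun z => gram (localImm m φ x₀) z i j) y :=
  contDiffAt_gram (contDiffAt_localImm hφ hy) i j

theorem continuousAt_sqrt_det_gram (hφ : IsSmoothIsometricImmersion m φ)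
    (hy : y ∈ (extChartAt (𝓡 m) x₀).target) :
    ContinuousAt (fun z => Real.sqrt (gram (localImm m φ x₀) z).det) y := by
  have h : ContinuousAt (fun z => (gram (localImm m φ x₀) z).det) y :=
    (contDiffAt_det (contDiffAt_gram_localImm hφ hy)).continuousAt
  exact Real.continuous_sqrt.continuousAt.comp h

theorem differential_mfderiv_param (hφ : IsSmoothIsometricImmersion m φ)
    (hy : y ∈ (extChartAt (𝓡 m) x₀).target) (v : EuclideanSpace ℝ (Fin m)) :
    differential m φ (param m x₀ y) (mfderiv (𝓡 m) (𝓡 m) (param m x₀) y v)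
      = fderiv ℝ (localImm m φ x₀) y v :=
  mvfderiv_mfderiv_param hφ.smooth hy v

theorem differential_coordVec (hφ : IsSmoothIsometricImmersion m φ)
    (hy : y ∈ (extChartAt (𝓡 m) x₀).target) (i : Fin m) :
    differential m φ (param m x₀ y) (coordVec m x₀ i y) = partialD i (localImm m φ x₀) y :=
  differential_mfderiv_param hφ hy _

/-- This replaces the abstract metric by the Gram matrix of the immersion, so that smoothness of the
coefficients comes from `φ`. -/
theorem metricMatrix_eq_gram (hφ : IsSmoothIsometricImmersion m φ)
    (hy : y ∈ (extChartAt (𝓡 m) x₀).target) :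
    metricMatrix m x₀ y = gram (localImm m φ x₀) y := by
  ext i j
  simp only [metricMatrix, gram, Matrix.of_apply]
  rw [← hφ.isometric, differential_coordVec hφ hy, differential_coordVec hφ hy]

theorem norm_mfderiv_param (hφ : IsSmoothIsometricImmersion m φ)
    (hy : y ∈ (extChartAt (𝓡 m) x₀).target) (v : EuclideanSpace ℝ (Fin m)) :
    ‖mfderiv (𝓡 m) (𝓡 m) (param m x₀) y v‖ = ‖fderiv ℝ (localImm m φ x₀) y v‖ := by
  rw [← sq_eq_sq₀ (norm_nonneg _) (norm_nonneg _), ← real_inner_self_eq_norm_sq,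
    ← real_inner_self_eq_norm_sq, ← differential_mfderiv_param hφ hy, hφ.isometric]

theorem posDef_gram_localImm (hφ : IsSmoothIsometricImmersion m φ)
    (hy : y ∈ (extChartAt (𝓡 m) x₀).target) : (gram (localImm m φ x₀) y).PosDef := by
  refine Matrix.posDef_gram_of_linearIndependent (𝕜 := ℝ)
    (v := fun i => partialD i (localImm m φ x₀) y) ?_
  rw [Fintype.linearIndependent_iff]
  intro c hc i
  set v : EuclideanSpace ℝ (Fin m) := ∑ i, c i • EuclideanSpace.single i (1 : ℝ) with hv
  have h1 : fderiv ℝ (localImm m φ x₀) y v = 0 := by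
    rw [← hc, hv, map_sum]
    exact Finset.sum_congr rfl fun i _ => by rw [map_smul]; rfl
  have h2 : mfderiv (𝓡 m) (𝓡 m) (param m x₀) y v = 0 := by
    rw [← norm_eq_zero, norm_mfderiv_param hφ hy, h1, norm_zero]
  have h3 : v = 0 := injective_mfderiv_param hy (h2.trans (map_zero _).symm)
  have h4 : v i = c i := by simp [hv, Pi.single_apply]
  rw [← h4, h3]
  rfl

theorem gram_localImm_eq {x₁ : M} (hφ : IsSmoothIsometricImmersion m φ)
    (hy : y ∈ (extChartAt (𝓡 m) x₁).target)
    (hy₀ : param m x₁ y ∈ (extChartAt (𝓡 m) x₀).source) :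
    gram (localImm m φ x₁) y = (jac (transition m x₀ x₁) y).transpose
      * gram (localImm m φ x₀) (transition m x₀ x₁ y) * jac (transition m x₀ x₁) y :=
  gram_comp (localImm_eventuallyEq hy hy₀)
    (contDiffAt_localImm hφ (transition_mem hy₀)).differentiableAt_of_infty
    (contDiffAt_transition hy hy₀).differentiableAt_of_infty

/-- The Gram determinant in one chart is `(det J)²` times that in the other, and it is positive. -/
theorem det_jac_transition_ne_zero {x₁ : M} (hφ : IsSmoothIsometricImmersion m φ)
    (hy : y ∈ (extChartAt (𝓡 m) x₁).target)
    (hy₀ : param m x₁ y ∈ (extChartAt (𝓡 m) x₀).source) :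
    (jac (transition m x₀ x₁) y).det ≠ 0 := by
  intro h
  have h1 := (posDef_gram_localImm hφ hy).det_pos
  rw [gram_localImm_eq hφ hy hy₀, Matrix.det_mul, h, mul_zero] at h1
  exact lt_irrefl _ h1

variable {V : Type*} [NormedAddCommGroup V] [InnerProductSpace ℝ V]

/-- The Laplacian of a function on `M`, for the metric induced by `φ`. -/
def manifoldLap (m : ℕ) {M : Type*} [TopologicalSpace M]
    [ChartedSpace (EuclideanSpace ℝ (Fin m)) M]
    (φ : M → Metric.sphere (0 : EuclideanSpace ℝ (Fin (n + 1))) r) (f : M → V) (p : M) : V :=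
  lap (gram (localImm m φ p)) (f ∘ param m p) (extChartAt (𝓡 m) p p)

/-- The pairing of the differentials of two functions on `M`, for the metric induced by `φ`. -/
def manifoldGradInner (m : ℕ) {M : Type*} [TopologicalSpace M]
    [ChartedSpace (EuclideanSpace ℝ (Fin m)) M]
    (φ : M → Metric.sphere (0 : EuclideanSpace ℝ (Fin (n + 1))) r) (f h : M → V) (p : M) : ℝ :=
  gradInner (gram (localImm m φ p)) (f ∘ param m p) (h ∘ param m p) (extChartAt (𝓡 m) p p)

theorem lap_chart_change {x₁ : M} (hφ : IsSmoothIsometricImmersion m φ) {f : M → V}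
    (hf : ContMDiff (𝓡 m) 𝓘(ℝ, V) ∞ f) (hy : y ∈ (extChartAt (𝓡 m) x₁).target)
    (hy₀ : param m x₁ y ∈ (extChartAt (𝓡 m) x₀).source) :
    lap (gram (localImm m φ x₁)) (f ∘ param m x₁) y
      = lap (gram (localImm m φ x₀)) (f ∘ param m x₀) (transition m x₀ x₁ y) :=
  lap_comp (localImm_eventuallyEq hy hy₀) (comp_param_eventuallyEq f hy hy₀)
    (contDiffAt_localImm hφ (transition_mem hy₀))
    (contDiffAt_comp_param hf (transition_mem hy₀))
    (contDiffAt_transition hy hy₀) (det_jac_transition_ne_zero hφ hy hy₀)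
    (posDef_gram_localImm hφ (transition_mem hy₀)).det_pos.ne'

theorem gradInner_chart_change {x₁ : M} (hφ : IsSmoothIsometricImmersion m φ) {f h : M → V}
    (hf : ContMDiff (𝓡 m) 𝓘(ℝ, V) ∞ f) (hh : ContMDiff (𝓡 m) 𝓘(ℝ, V) ∞ h)
    (hy : y ∈ (extChartAt (𝓡 m) x₁).target)
    (hy₀ : param m x₁ y ∈ (extChartAt (𝓡 m) x₀).source) :
    gradInner (gram (localImm m φ x₁)) (f ∘ param m x₁) (h ∘ param m x₁) y
      = gradInner (gram (localImm m φ x₀)) (f ∘ param m x₀) (h ∘ param m x₀)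
        (transition m x₀ x₁ y) :=
  gradInner_comp (localImm_eventuallyEq hy hy₀) (comp_param_eventuallyEq f hy hy₀)
    (comp_param_eventuallyEq h hy hy₀)
    (contDiffAt_localImm hφ (transition_mem hy₀)).differentiableAt_of_infty
    (contDiffAt_comp_param hf (transition_mem hy₀)).differentiableAt_of_infty
    (contDiffAt_comp_param hh (transition_mem hy₀)).differentiableAt_of_infty
    (contDiffAt_transition hy hy₀).differentiableAt_of_infty
    (det_jac_transition_ne_zero hφ hy hy₀)

/-- The definition uses a chart that varies with the point. Invariance gives a formula in one fixed
chart, which is needed for smoothness and for integration. -/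
theorem manifoldLap_param (hφ : IsSmoothIsometricImmersion m φ) {f : M → V}
    (hf : ContMDiff (𝓡 m) 𝓘(ℝ, V) ∞ f) (hy : y ∈ (extChartAt (𝓡 m) x₀).target) :
    manifoldLap m φ f (param m x₀ y) = lap (gram (localImm m φ x₀)) (f ∘ param m x₀) y := by
  have h1 := lap_chart_change hφ hf hy (mem_extChartAt_source (I := 𝓡 m) (param m x₀ y))
  exact h1.symm

theorem manifoldGradInner_param (hφ : IsSmoothIsometricImmersion m φ) {f h : M → V}
    (hf : ContMDiff (𝓡 m) 𝓘(ℝ, V) ∞ f) (hh : ContMDiff (𝓡 m) 𝓘(ℝ, V) ∞ h)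
    (hy : y ∈ (extChartAt (𝓡 m) x₀).target) :
    manifoldGradInner m φ f h (param m x₀ y)
      = gradInner (gram (localImm m φ x₀)) (f ∘ param m x₀) (h ∘ param m x₀) y :=
  (gradInner_chart_change hφ hf hh hy (mem_extChartAt_source (I := 𝓡 m) (param m x₀ y))).symm

end Immersion

/-! ### Smoothness of the operators and the projection onto the tangent space of the sphere. -/

section Regularity

variable {m : ℕ} {V F : Type*} [NormedAddCommGroup V] [NormedSpace ℝ V]
  [NormedAddCommGroup F] [InnerProductSpace ℝ F] {y : EuclideanSpace ℝ (Fin m)}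

theorem chr_congr {G G' : EuclideanSpace ℝ (Fin m) → Matrix (Fin m) (Fin m) ℝ}
    (hG : G =ᶠ[nhds y] G') (k i j : Fin m) : chr G k i j y = chr G' k i j y := by
  have : ∀ a b, (fun z => G z a b) =ᶠ[nhds y] fun z => G' z a b := fun a b =>
    hG.mono fun z hz => by simp only [hz]
  simp only [chr, hG.eq_of_nhds, partialD_congr (this _ _)]

theorem contDiffAt_lap {G : EuclideanSpace ℝ (Fin m) → Matrix (Fin m) (Fin m) ℝ}
    (hG : ∀ i j, ContDiffAt ℝ ∞ (fun z => G z i j) y) (hdet : (G y).det ≠ 0)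
    {f : EuclideanSpace ℝ (Fin m) → V} (hf : ContDiffAt ℝ ∞ f y) : ContDiffAt ℝ ∞ (lap G f) y := by
  have hc : ∀ k i j, ContDiffAt ℝ ∞ (chr G k i j) y := fun k i j =>
    contDiffAt_const.mul <| ContDiffAt.sum fun l _ =>
      (contDiffAt_matrix_inv hG hdet k l).mul <|
        ((contDiffAt_partialD (hG j l) i).add (contDiffAt_partialD (hG i l) j)).sub
          (contDiffAt_partialD (hG i j) l)
  exact ContDiffAt.sum fun i _ => ContDiffAt.sum fun j _ =>
    (contDiffAt_matrix_inv hG hdet i j).smul <|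
      (contDiffAt_partialD (contDiffAt_partialD hf j) i).sub <|
        ContDiffAt.sum fun k _ => (hc k i j).smul (contDiffAt_partialD hf k)

theorem contDiffAt_gradInner {G : EuclideanSpace ℝ (Fin m) → Matrix (Fin m) (Fin m) ℝ}
    (hG : ∀ i j, ContDiffAt ℝ ∞ (fun z => G z i j) y) (hdet : (G y).det ≠ 0)
    {f h : EuclideanSpace ℝ (Fin m) → F} (hf : ContDiffAt ℝ ∞ f y) (hh : ContDiffAt ℝ ∞ h y) :
    ContDiffAt ℝ ∞ (gradInner G f h) y :=
  ContDiffAt.sum fun i _ => ContDiffAt.sum fun j _ =>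
    (contDiffAt_matrix_inv hG hdet i j).mul <|
      (contDiffAt_partialD hf i).inner ℝ (contDiffAt_partialD hh j)

theorem gradInner_gram_self {Φ : EuclideanSpace ℝ (Fin m) → F} (hdet : (gram Φ y).det ≠ 0) :
    gradInner (gram Φ) Φ Φ y = m := by
  have h1 : ∀ i, ∑ j, (gram Φ y)⁻¹ i j * inner ℝ (partialD i Φ y) (partialD j Φ y) = 1 := by
    intro i
    have h2 := congrFun (congrFun
      (Matrix.nonsing_inv_mul (gram Φ y) (isUnit_iff_ne_zero.2 hdet)) i) i
    rw [Matrix.mul_apply, Matrix.one_apply_eq] at h2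
    rw [← h2]
    exact Finset.sum_congr rfl fun j _ => by rw [gram_comm]; rfl
  simp [gradInner, h1]

theorem tangentProj_eq {n : ℕ} {K : ℝ} (hK : 0 < K) {q : EuclideanSpace ℝ (Fin (n + 1))}
    (hq : inner ℝ q q = 1 / K) (v : EuclideanSpace ℝ (Fin (n + 1))) :
    tangentProj q v = v - (K * inner ℝ q v) • q := by
  rw [tangentProj, Submodule.starProjection_orthogonal_val, Submodule.starProjection_singleton]
  congr 2
  have : ((‖q‖ ^ 2 : ℝ) : ℝ) = 1 / K := by rw [← real_inner_self_eq_norm_sq, hq]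
  simp only [RCLike.ofReal_real_eq_id, id_eq]
  rw [this]
  field_simp

theorem inner_incl_self {n : ℕ} {K : ℝ} {M : Type*} (hK : 0 < K)
    {φ : M → Metric.sphere (0 : EuclideanSpace ℝ (Fin (n + 1))) (1 / Real.sqrt K)} (p : M) :
    inner ℝ (incl φ p) (incl φ p) = 1 / K := by
  have h : ‖incl φ p‖ = 1 / Real.sqrt K := mem_sphere_zero_iff_norm.1 (φ p).2
  rw [real_inner_self_eq_norm_sq, h, div_pow, Real.sq_sqrt hK.le, one_pow]

end Regularity

/-! ### The tension field as an ambient vector field. -/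

section Tension

variable {m n : ℕ} {K : ℝ} {M : Type*} [TopologicalSpace M]
  [ChartedSpace (EuclideanSpace ℝ (Fin m)) M]
  {φ : M → Metric.sphere (0 : EuclideanSpace ℝ (Fin (n + 1))) (1 / Real.sqrt K)} {x₀ : M}
  {y : EuclideanSpace ℝ (Fin m)}

theorem contMDiff_of_comp_param {V : Type*} [NormedAddCommGroup V] [NormedSpace ℝ V] {f : M → V}
    (hf : ∀ (x₀ : M), ∀ y ∈ (extChartAt (𝓡 m) x₀).target, ContDiffAt ℝ ∞ (f ∘ param m x₀) y) :
    ContMDiff (𝓡 m) 𝓘(ℝ, V) ∞ f := by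
  intro p
  have h1 := (contMDiffAt_iff_contDiffAt.2 (hf p _ (mem_extChartAt_target (I := 𝓡 m) p))).comp p
    (contMDiffAt_extChartAt (I := 𝓡 m) (n := ∞) (x := p))
  refine h1.congr_of_eventuallyEq ?_
  filter_upwards [extChartAt_source_mem_nhds (I := 𝓡 m) p] with z hz
  simp only [Function.comp_apply, param]
  rw [(extChartAt (𝓡 m) p).left_inv hz]

variable [IsManifold (𝓡 m) ∞ M] [RiemannianBundle (fun x : M => TangentSpace (𝓡 m) x)]

theorem inner_localImm_partialD (hK : 0 < K) (hφ : IsSmoothIsometricImmersion m φ)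
    (hy : y ∈ (extChartAt (𝓡 m) x₀).target) (j : Fin m) :
    inner ℝ (localImm m φ x₀ y) (partialD j (localImm m φ x₀) y) = 0 := by
  have d := (contDiffAt_localImm hφ hy).differentiableAt_of_infty
  have h1 := partialD_inner d d j
  have h2 : (fun z => inner ℝ (localImm m φ x₀ z) (localImm m φ x₀ z)) = fun _ => 1 / K :=
    funext fun z => inner_incl_self hK _
  rw [h2, real_inner_comm (localImm m φ x₀ y)] at h1
  have h3 : partialD j (fun _ : EuclideanSpace ℝ (Fin m) => 1 / K) y = 0 := by simp [partialD]
  linarith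

/-- Since `Φ` is orthogonal to the image of `dΦ`, differentiating once more and tracing gives `-⟨Φ,
ΔΦ⟩ = |dΦ|² = m`. -/
theorem inner_localImm_lap (hK : 0 < K) (hφ : IsSmoothIsometricImmersion m φ)
    (hy : y ∈ (extChartAt (𝓡 m) x₀).target) :
    inner ℝ (localImm m φ x₀ y) (lap (gram (localImm m φ x₀)) (localImm m φ x₀) y) = -m := by
  have h1 := gradInner_eq_neg_inner_lap (G := gram (localImm m φ x₀))
    (contDiffAt_localImm hφ hy)
    (contDiffAt_localImm hφ hy).differentiableAt_of_infty (by
      filter_upwards [(isOpen_extChartAt_target x₀).mem_nhds hy] with z hz j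
      exact inner_localImm_partialD hK hφ hz j)
  rw [gradInner_gram_self (posDef_gram_localImm hφ hy).det_pos.ne'] at h1
  linarith

/-- The trace of `∇̄α` when `α` is, in the chart, the tangential differential of `f`. -/
theorem traceConn_eq (hφ : IsSmoothIsometricImmersion m φ)
    {α : ∀ p : M, TangentSpace (𝓡 m) p →L[ℝ] EuclideanSpace ℝ (Fin (n + 1))}
    {f : EuclideanSpace ℝ (Fin m) → EuclideanSpace ℝ (Fin (n + 1))} (p : M)
    (hα : ∀ z ∈ (extChartAt (𝓡 m) p).target, ∀ j,
      α (param m p z) (coordVec m p j z) = partialD j f z)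
    (hP : ∀ j, tangentProj (incl φ p) (partialD j f (extChartAt (𝓡 m) p p))
      = partialD j f (extChartAt (𝓡 m) p p)) :
    traceConn m φ α p
      = tangentProj (incl φ p) (lap (gram (localImm m φ p)) f (extChartAt (𝓡 m) p p)) := by
  have hy := mem_extChartAt_target (I := 𝓡 m) p
  have hnhds := (isOpen_extChartAt_target (I := 𝓡 m) p).mem_nhds hy
  have e1 : ∀ j, (fun z => α (param m p z) (coordVec m p j z))
      =ᶠ[nhds (extChartAt (𝓡 m) p p)] partialD j f := fun j => by
    filter_upwards [hnhds] with z hz using hα z hz j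
  have e2 : metricMatrix m p =ᶠ[nhds (extChartAt (𝓡 m) p p)] gram (localImm m φ p) := by
    filter_upwards [hnhds] with z hz using metricMatrix_eq_gram hφ hz
  have e3 : ∀ k i j, christoffel m p k i j (extChartAt (𝓡 m) p p)
      = chr (gram (localImm m φ p)) k i j (extChartAt (𝓡 m) p p) := fun k i j => chr_congr e2 k i j
  simp only [traceConn, lap, map_sum, map_smul, map_sub, hP, partialD_congr (e1 _),
    (e1 _).eq_of_nhds, e2.eq_of_nhds, e3]

/-- Beltrami's formula: `|φ|² = 1/K` forces the radial part of the ambient Laplacian to be `-mKφ`,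
and the projection removes it. -/
theorem tensionField_eq (hK : 0 < K) (hφ : IsSmoothIsometricImmersion m φ) (p : M) :
    tensionField m φ p = manifoldLap m φ (incl φ) p + (m * K) • incl φ p := by
  have hy := mem_extChartAt_target (I := 𝓡 m) p
  have hp : localImm m φ p (extChartAt (𝓡 m) p p) = incl φ p := by
    rw [localImm, Function.comp_apply, param_extChartAt_self]
  have h1 := inner_localImm_partialD hK hφ hy
  have h2 := inner_localImm_lap hK hφ hy
  rw [hp] at h1 h2
  rw [tensionField, traceConn_eq (f := localImm m φ p) hφ p
    (fun z hz j => differential_coordVec hφ hz j)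
    (fun j => by rw [tangentProj_eq hK (inner_incl_self hK p), h1 j, mul_zero, zero_smul,
      sub_zero]), tangentProj_eq hK (inner_incl_self hK p), h2, manifoldLap]
  change _ - _ = lap (gram (localImm m φ p)) (localImm m φ p) _ + _
  rw [sub_eq_add_neg, ← neg_smul]
  congr 2
  ring

theorem tensionField_param (hK : 0 < K) (hφ : IsSmoothIsometricImmersion m φ)
    (hy : y ∈ (extChartAt (𝓡 m) x₀).target) :
    tensionField m φ (param m x₀ y)
      = lap (gram (localImm m φ x₀)) (localImm m φ x₀) y + (m * K) • localImm m φ x₀ y := by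
  rw [tensionField_eq hK hφ, manifoldLap_param hφ hφ.smooth hy]
  rfl

theorem contMDiff_tensionField (hK : 0 < K) (hφ : IsSmoothIsometricImmersion m φ) :
    ContMDiff (𝓡 m) 𝓘(ℝ, EuclideanSpace ℝ (Fin (n + 1))) ∞ (tensionField m φ) := by
  refine contMDiff_of_comp_param fun x₀ y hy => ?_
  have h1 : ContDiffAt ℝ ∞ (fun z => lap (gram (localImm m φ x₀)) (localImm m φ x₀) z
      + (m * K) • localImm m φ x₀ z) y :=
    (contDiffAt_lap (contDiffAt_gram_localImm hφ hy) (posDef_gram_localImm hφ hy).det_pos.ne'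
      (contDiffAt_localImm hφ hy)).add ((contDiffAt_localImm hφ hy).const_smul _)
  refine h1.congr_of_eventuallyEq ?_
  filter_upwards [(isOpen_extChartAt_target x₀).mem_nhds hy] with z hz
  exact tensionField_param hK hφ hz

theorem inner_tensionField_localImm (hK : 0 < K) (hφ : IsSmoothIsometricImmersion m φ)
    (hy : y ∈ (extChartAt (𝓡 m) x₀).target) :
    inner ℝ (tensionField m φ (param m x₀ y)) (localImm m φ x₀ y) = 0 := by
  rw [tensionField_param hK hφ hy, inner_add_left, real_inner_comm, inner_localImm_lap hK hφ hy,
    inner_smul_left, localImm, Function.comp_apply, inner_incl_self hK]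
  simp only [conj_trivial]
  field_simp
  ring

/-- For an isometric immersion the tension field is the unnormalised mean curvature vector: both
`ΔΦ` and `Φ` are normal to the image of `dΦ`. -/
theorem inner_tensionField_partialD (hK : 0 < K) (hφ : IsSmoothIsometricImmersion m φ)
    (hy : y ∈ (extChartAt (𝓡 m) x₀).target) (j : Fin m) :
    inner ℝ (tensionField m φ (param m x₀ y)) (partialD j (localImm m φ x₀) y) = 0 := by
  rw [tensionField_param hK hφ hy, inner_add_left, inner_smul_left,
    inner_localImm_partialD hK hφ hy, inner_lap_partialD (contDiffAt_localImm hφ hy)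
      (posDef_gram_localImm hφ hy).det_pos.ne', mul_zero, add_zero]

/-- The derivatives of the tension field are already tangent to the sphere. -/
theorem inner_localImm_partialD_tensionField (hK : 0 < K) (hφ : IsSmoothIsometricImmersion m φ)
    (hy : y ∈ (extChartAt (𝓡 m) x₀).target) (j : Fin m) :
    inner ℝ (localImm m φ x₀ y) (partialD j (tensionField m φ ∘ param m x₀) y) = 0 := by
  -- Differentiate `⟨τ, Φ⟩ = 0`; the term `⟨τ, ∂_j Φ⟩` vanishes because `τ` is normal.
  have h1 := partialD_inner
    (contDiffAt_comp_param (contMDiff_tensionField hK hφ) hy).differentiableAt_of_infty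
    (contDiffAt_localImm hφ hy).differentiableAt_of_infty j
  have h2 : (fun z => inner ℝ ((tensionField m φ ∘ param m x₀) z) (localImm m φ x₀ z))
      =ᶠ[nhds y] fun _ => (0 : ℝ) := by
    filter_upwards [(isOpen_extChartAt_target x₀).mem_nhds hy] with z hz
    exact inner_tensionField_localImm hK hφ hz
  have h3 : partialD j (fun _ : EuclideanSpace ℝ (Fin m) => (0 : ℝ)) y = 0 := by simp [partialD]
  rw [partialD_congr h2, h3, Function.comp_apply, inner_tensionField_partialD hK hφ hy,
    zero_add, real_inner_comm] at h1
  exact h1.symm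

/-- Since the derivatives of `τ` are tangent to the sphere, the two Laplacians differ only by a
multiple of `φ`, which the pairing with `τ` does not see. -/
theorem inner_connLaplacian_tensionField (hK : 0 < K) (hφ : IsSmoothIsometricImmersion m φ)
    (p : M) : inner ℝ (connLaplacian m φ (tensionField m φ) p) (tensionField m φ p)
      = inner ℝ (manifoldLap m φ (tensionField m φ) p) (tensionField m φ p) := by
  have hy := mem_extChartAt_target (I := 𝓡 m) p
  have hp : localImm m φ p (extChartAt (𝓡 m) p p) = incl φ p := by
    rw [localImm, Function.comp_apply, param_extChartAt_self]
  have hq := inner_incl_self (φ := φ) hK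
  have hP : ∀ z ∈ (extChartAt (𝓡 m) p).target, ∀ j, tangentProj (incl φ (param m p z))
      (partialD j (tensionField m φ ∘ param m p) z)
        = partialD j (tensionField m φ ∘ param m p) z := by
    intro z hz j
    have h1 := inner_localImm_partialD_tensionField hK hφ hz j
    simp only [localImm, Function.comp_apply] at h1
    rw [tangentProj_eq hK (hq _), h1, mul_zero, zero_smul, sub_zero]
  rw [connLaplacian, traceConn_eq (f := tensionField m φ ∘ param m p) hφ p]
  · have h3 := inner_tensionField_localImm hK hφ hy
    rw [hp, param_extChartAt_self] at h3
    rw [tangentProj_eq hK (hq p), inner_sub_left, inner_smul_left,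
      real_inner_comm (tensionField m φ p) (incl φ p), h3, mul_zero, sub_zero, manifoldLap]
  · intro z hz j
    rw [← hP z hz j]
    change tangentProj _ (mvfderiv (𝓡 m) (tensionField m φ) (param m p z) (coordVec m p j z)) = _
    congr 1
    exact mvfderiv_mfderiv_param (contMDiff_tensionField hK hφ) hz _
  · intro j
    have h4 := hP _ hy j
    rwa [param_extChartAt_self] at h4

/-- The Bochner identity for `|τ|²`. For `c ≥ 0` both terms on the right are nonnegative. -/
theorem manifoldLap_inner_tensionField (hK : 0 < K) (hφ : IsSmoothIsometricImmersion m φ) {c : ℝ}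
    (heq : ∀ p, connLaplacian m φ (tensionField m φ) p = c • tensionField m φ p) (p : M) :
    manifoldLap m φ (fun q => (inner ℝ (tensionField m φ q) (tensionField m φ q) : ℝ)) p
      = 2 * (c * inner ℝ (tensionField m φ p) (tensionField m φ p))
        + 2 * manifoldGradInner m φ (tensionField m φ) (tensionField m φ) p := by
  have h1 := inner_connLaplacian_tensionField hK hφ p
  rw [heq, inner_smul_left, conj_trivial] at h1
  rw [h1]
  have h2 := lap_inner_self (G := gram (localImm m φ p)) (contDiffAt_comp_param
    (contMDiff_tensionField hK hφ) (mem_extChartAt_target (I := 𝓡 m) p))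
  rw [Function.comp_apply, param_extChartAt_self] at h2
  exact h2

/-- A map whose tension field has vanishing differential is harmonic. -/
theorem tensionField_eq_zero (hK : 0 < K) (hφ : IsSmoothIsometricImmersion m φ) {p : M}
    (h0 : manifoldGradInner m φ (tensionField m φ) (tensionField m φ) p = 0) :
    tensionField m φ p = 0 := by
  have hy := mem_extChartAt_target (I := 𝓡 m) p
  have h1 : ∀ i, partialD i (tensionField m φ ∘ param m p) (extChartAt (𝓡 m) p p) = 0 :=
    partialD_eq_zero_of_gradInner_self (posDef_gram_localImm hφ hy) h0
  -- The left side vanishes with `dτ`; the right side is `-|τ|²`, because `ΔΦ = τ - mKΦ` and `τ` is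
  -- orthogonal to `Φ`.
  have h2 := gradInner_eq_neg_inner_lap (G := gram (localImm m φ p))
    (T := tensionField m φ ∘ param m p) (contDiffAt_localImm hφ hy)
    (contDiffAt_comp_param (contMDiff_tensionField hK hφ) hy).differentiableAt_of_infty (by
      filter_upwards [(isOpen_extChartAt_target p).mem_nhds hy] with z hz j
      exact inner_tensionField_partialD hK hφ hz j)
  have h3 : lap (gram (localImm m φ p)) (localImm m φ p) (extChartAt (𝓡 m) p p)
      = tensionField m φ p - (m * K) • localImm m φ p (extChartAt (𝓡 m) p p) := by
    have := tensionField_param hK hφ hy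
    rw [param_extChartAt_self] at this
    rw [this, add_sub_cancel_right]
  have h4 := inner_tensionField_localImm hK hφ hy
  rw [param_extChartAt_self] at h4
  simp only [gradInner, h1, inner_zero_left, mul_zero, Finset.sum_const_zero, h3,
    Function.comp_apply, param_extChartAt_self, inner_sub_right, inner_smul_right, h4,
    sub_zero] at h2
  exact inner_self_eq_zero.1 (by linarith : inner ℝ (tensionField m φ p) (tensionField m φ p) = 0)

end Tension

/-! ### The Riemannian volume measure. -/

section Volume

variable {m n : ℕ} {r : ℝ} {M : Type*} [TopologicalSpace M]
  [ChartedSpace (EuclideanSpace ℝ (Fin m)) M] {x₀ : M}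

theorem measurableSet_target :
    MeasurableSet (extChartAt (𝓡 m) x₀).target := (isOpen_extChartAt_target x₀).measurableSet

theorem aemeasurable_param [MeasurableSpace M] [BorelSpace M] (g : EuclideanSpace ℝ (Fin m) → ℝ≥0∞) :
    AEMeasurable (param m x₀)
      ((volume.restrict (extChartAt (𝓡 m) x₀).target).withDensity g) :=
  ((continuousOn_extChartAt_symm x₀).aemeasurable measurableSet_target).mono_ac
    (withDensity_absolutelyContinuous _ _)

theorem measurableSet_preimage_param_inter [MeasurableSpace M] [BorelSpace M] {A : Set M}
    (hA : MeasurableSet A) :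
    MeasurableSet (param m x₀ ⁻¹' A ∩ (extChartAt (𝓡 m) x₀).target) := by
  have h1 : Measurable ((extChartAt (𝓡 m) x₀).target.domRestrict (param m x₀)) :=
    (continuousOn_iff_continuous_domRestrict.1 (continuousOn_extChartAt_symm x₀)).measurable
  have h2 := measurableSet_target.subtype_image (h1 hA)
  convert h2 using 1
  ext y
  constructor
  · rintro ⟨h, hy⟩
    exact ⟨⟨y, hy⟩, h, rfl⟩
  · rintro ⟨⟨z, hz⟩, h, rfl⟩
    exact ⟨h, hz⟩

variable [RiemannianBundle (fun x : M => TangentSpace (𝓡 m) x)] [MeasurableSpace M] [BorelSpace M]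

theorem chartVolume_apply {A : Set M} (hA : MeasurableSet A) :
    chartVolume m x₀ A = ∫⁻ y in param m x₀ ⁻¹' A ∩ (extChartAt (𝓡 m) x₀).target,
      ENNReal.ofReal (Real.sqrt (metricMatrix m x₀ y).det) := by
  rw [chartVolume, Measure.map_apply_of_aemeasurable (aemeasurable_param _) hA,
    withDensity_apply', Measure.restrict_restrict' measurableSet_target]

theorem chartVolume_compl_source : chartVolume m x₀ (extChartAt (𝓡 m) x₀).sourceᶜ = 0 := by
  rw [chartVolume_apply (isOpen_extChartAt_source x₀).measurableSet.compl]
  have : param m x₀ ⁻¹' (extChartAt (𝓡 m) x₀).sourceᶜ ∩ (extChartAt (𝓡 m) x₀).target = ∅ := by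
    ext y
    simp only [mem_inter_iff, mem_preimage, mem_compl_iff, mem_empty_iff_false, iff_false, not_and]
    exact fun h1 h2 => h1 ((extChartAt (𝓡 m) x₀).map_target h2)
  rw [this]
  simp

theorem chartVolume_inter_source (B : Set M) :
    chartVolume m x₀ (B ∩ (extChartAt (𝓡 m) x₀).source) = chartVolume m x₀ B :=
  measure_inter_conull chartVolume_compl_source

variable [IsManifold (𝓡 m) ∞ M]
  {φ : M → Metric.sphere (0 : EuclideanSpace ℝ (Fin (n + 1))) r}

theorem chartVolume_apply_gram (hφ : IsSmoothIsometricImmersion m φ) {A : Set M}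
    (hA : MeasurableSet A) :
    chartVolume m x₀ A = ∫⁻ y in param m x₀ ⁻¹' A ∩ (extChartAt (𝓡 m) x₀).target,
      ENNReal.ofReal (Real.sqrt (gram (localImm m φ x₀) y).det) := by
  rw [chartVolume_apply hA]
  refine setLIntegral_congr_fun (measurableSet_preimage_param_inter hA) fun y hy => ?_
  simp only [metricMatrix_eq_gram hφ hy.2]

/-- The chart measures agree on overlaps of chart domains. -/
theorem chartVolume_eq (hφ : IsSmoothIsometricImmersion m φ) {x₁ : M} {A : Set M}
    (hA : MeasurableSet A) (h₀ : A ⊆ (extChartAt (𝓡 m) x₀).source)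
    (h₁ : A ⊆ (extChartAt (𝓡 m) x₁).source) : chartVolume m x₀ A = chartVolume m x₁ A := by
  set S := param m x₁ ⁻¹' A ∩ (extChartAt (𝓡 m) x₁).target with hS
  have himg : transition m x₀ x₁ '' S = param m x₀ ⁻¹' A ∩ (extChartAt (𝓡 m) x₀).target := by
    ext y
    constructor
    · rintro ⟨z, ⟨hzA, hzT⟩, rfl⟩
      refine ⟨?_, transition_mem (h₀ hzA)⟩
      rw [mem_preimage, param_transition (h₀ hzA)]
      exact hzA
    · rintro ⟨hyA, hyT⟩
      refine ⟨transition m x₁ x₀ y, ⟨?_, transition_mem (h₁ hyA)⟩, ?_⟩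
      · rw [mem_preimage, param_transition (h₁ hyA)]
        exact hyA
      · change extChartAt (𝓡 m) x₀ (param m x₁ (transition m x₁ x₀ y)) = y
        rw [param_transition (h₁ hyA)]
        exact (extChartAt (𝓡 m) x₀).right_inv hyT
  have hinj : InjOn (transition m x₀ x₁) S := by
    intro y hy z hz hyz
    have h := congrArg (param m x₀) hyz
    rw [param_transition (h₀ hy.1), param_transition (h₀ hz.1)] at h
    exact (extChartAt (𝓡 m) x₁).symm.injOn hy.2 hz.2 h
  rw [chartVolume_apply_gram hφ hA, chartVolume_apply_gram hφ hA, ← himg,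
    lintegral_image_eq_lintegral_abs_det_fderiv_mul volume (measurableSet_preimage_param_inter hA)
      (fun y hy => (contDiffAt_transition hy.2
        (h₀ hy.1)).differentiableAt_of_infty.hasFDerivAt.hasFDerivWithinAt) hinj]
  refine setLIntegral_congr_fun (measurableSet_preimage_param_inter hA) fun y hy => ?_
  rw [gram_localImm_eq hφ hy.2 (h₀ hy.1), Matrix.det_mul, Matrix.det_mul, Matrix.det_transpose,
    ← ENNReal.ofReal_mul (abs_nonneg _), ← det_jac]
  congr 1
  rw [show ∀ a b : ℝ, a * b * a = a ^ 2 * b by intro a b; ring, Real.sqrt_mul (sq_nonneg _),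
    Real.sqrt_sq_eq_abs]

variable [SecondCountableTopology M]

/-- The supremum of the chart measures is compared with a measure `ν` glued over a countable
disjoint refinement of the chart domains: `ν` dominates every chart measure and agrees with each on
its own domain. -/
theorem riemannianVolume_apply (hφ : IsSmoothIsometricImmersion m φ) {B : Set M}
    (hB : MeasurableSet B) (hsub : B ⊆ (extChartAt (𝓡 m) x₀).source) :
    riemannianVolume m M B = chartVolume m x₀ B := by
  obtain ⟨s, hs, hcov⟩ := TopologicalSpace.countable_cover_nhds
    (fun x : M => extChartAt_source_mem_nhds (I := 𝓡 m) x)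
  have hne : s.Nonempty := by
    have : x₀ ∈ ⋃ x ∈ s, (extChartAt (𝓡 m) x).source := hcov ▸ mem_univ x₀
    obtain ⟨x, hx, -⟩ := mem_iUnion₂.1 this
    exact ⟨x, hx⟩
  obtain ⟨e, rfl⟩ := hs.exists_eq_range hne
  rw [biUnion_range] at hcov
  set A : ℕ → Set M := disjointed fun k => (extChartAt (𝓡 m) (e k)).source with hAdef
  have hAm : ∀ k, MeasurableSet (A k) := fun k =>
    MeasurableSet.disjointed (fun k => (isOpen_extChartAt_source (e k)).measurableSet) k
  have hAsub : ∀ k, A k ⊆ (extChartAt (𝓡 m) (e k)).source := fun k => disjointed_subset _ k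
  have hAU : ⋃ k, A k = univ := by rw [hAdef, iUnion_disjointed, hcov]
  have hAd : Pairwise (Function.onFun Disjoint A) := disjoint_disjointed _
  set ν : Measure M := Measure.sum fun k => (chartVolume m (e k)).restrict (A k) with hν
  have key : ∀ (x : M) (C : Set M), MeasurableSet C → C ⊆ (extChartAt (𝓡 m) x).source →
      ν C = chartVolume m x C := by
    intro x C hC hCsub
    rw [hν, Measure.sum_apply _ hC]
    have h1 : ∀ k, (chartVolume m (e k)).restrict (A k) C = chartVolume m x (C ∩ A k) := fun k => by
      rw [Measure.restrict_apply hC]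
      exact chartVolume_eq hφ (hC.inter (hAm k)) (inter_subset_right.trans (hAsub k))
        (inter_subset_left.trans hCsub)
    simp_rw [h1]
    rw [← measure_iUnion (fun i j hij => (hAd hij).mono inter_subset_right inter_subset_right)
      (fun k => hC.inter (hAm k)), ← inter_iUnion, hAU, inter_univ]
  have hle : riemannianVolume m M ≤ ν := by
    refine iSup_le fun x => Measure.le_iff.2 fun C hC => ?_
    rw [← chartVolume_inter_source C,
      ← key x _ (hC.inter (isOpen_extChartAt_source x).measurableSet) inter_subset_right]
    exact measure_mono inter_subset_left
  refine le_antisymm ((hle B).trans_eq (key x₀ B hB hsub)) ?_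
  exact (le_iSup (fun x : M => chartVolume m x) x₀ : chartVolume m x₀ ≤ riemannianVolume m M) B

theorem riemannianVolume_restrict_source (hφ : IsSmoothIsometricImmersion m φ) (x₀ : M) :
    (riemannianVolume m M).restrict (extChartAt (𝓡 m) x₀).source = chartVolume m x₀ := by
  ext B hB
  rw [Measure.restrict_apply hB, riemannianVolume_apply hφ
    (hB.inter (isOpen_extChartAt_source x₀).measurableSet) inter_subset_right,
    chartVolume_inter_source B]

/-- This makes continuous functions with compact support integrable. Near a point the coordinates
and the density `√det g` are bounded. -/
theorem isLocallyFiniteMeasure_riemannianVolume (hφ : IsSmoothIsometricImmersion m φ) :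
    IsLocallyFiniteMeasure (riemannianVolume m M) := by
  refine ⟨fun p => ?_⟩
  have hy := mem_extChartAt_target (I := 𝓡 m) p
  set y := extChartAt (𝓡 m) p p with hydef
  have h1 : ∀ᶠ z in nhds y, z ∈ Metric.ball y 1 ∧
      Real.sqrt (gram (localImm m φ p) z).det < Real.sqrt (gram (localImm m φ p) y).det + 1 :=
    Filter.Eventually.and (Metric.ball_mem_nhds y one_pos)
      ((continuousAt_sqrt_det_gram hφ hy).eventually_lt_const (by linarith))
  obtain ⟨W, hW, hWo, hyW⟩ := eventually_nhds_iff.1 h1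
  have hcont : ContinuousAt (extChartAt (𝓡 m) p) p := continuousAt_extChartAt p
  have h2 : ∀ᶠ q in nhds p, q ∈ (extChartAt (𝓡 m) p).source ∧ extChartAt (𝓡 m) p q ∈ W :=
    Filter.Eventually.and (extChartAt_source_mem_nhds (I := 𝓡 m) p)
      (hcont.eventually_mem (hWo.mem_nhds hyW))
  obtain ⟨U, hU, hUo, hpU⟩ := eventually_nhds_iff.1 h2
  refine ⟨U, hUo.mem_nhds hpU, ?_⟩
  rw [riemannianVolume_apply hφ hUo.measurableSet (fun q hq => (hU q hq).1),
    chartVolume_apply_gram hφ hUo.measurableSet]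
  have hsub : ∀ z ∈ param m p ⁻¹' U ∩ (extChartAt (𝓡 m) p).target, z ∈ W := by
    rintro z ⟨hz1, hz2⟩
    have := (hU _ hz1).2
    rwa [param, (extChartAt (𝓡 m) p).right_inv hz2] at this
  refine lt_of_le_of_lt (setLIntegral_mono' (g := fun _ =>
    ENNReal.ofReal (Real.sqrt (gram (localImm m φ p) y).det + 1))
    (measurableSet_preimage_param_inter hUo.measurableSet) fun z hz =>
      ENNReal.ofReal_le_ofReal (hW z (hsub z hz)).2.le) ?_
  rw [setLIntegral_const]
  refine ENNReal.mul_lt_top ENNReal.ofReal_lt_top ?_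
  exact (measure_mono fun z hz => (hW z (hsub z hz)).1).trans_lt measure_ball_lt_top

/-- This turns vanishing almost everywhere of a continuous function into vanishing at every point.
The density is positive. -/
theorem isOpenPosMeasure_riemannianVolume (hφ : IsSmoothIsometricImmersion m φ) :
    (riemannianVolume m M).IsOpenPosMeasure := by
  refine ⟨fun U hU hne h0 => ?_⟩
  obtain ⟨p, hp⟩ := hne
  have hUo : IsOpen (U ∩ (extChartAt (𝓡 m) p).source) := hU.inter (isOpen_extChartAt_source p)
  have h1 : riemannianVolume m M (U ∩ (extChartAt (𝓡 m) p).source) = 0 :=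
    measure_mono_null inter_subset_left h0
  rw [riemannianVolume_apply hφ hUo.measurableSet inter_subset_right,
    chartVolume_apply_gram hφ hUo.measurableSet] at h1
  set S := param m p ⁻¹' (U ∩ (extChartAt (𝓡 m) p).source) ∩ (extChartAt (𝓡 m) p).target with hS
  have hSm : MeasurableSet S := measurableSet_preimage_param_inter hUo.measurableSet
  have hSo : IsOpen S := by
    rw [hS, inter_comm]
    exact (continuousOn_extChartAt_symm p).isOpen_inter_preimage (isOpen_extChartAt_target p) hUo
  have hSne : S.Nonempty := by
    refine ⟨extChartAt (𝓡 m) p p, ?_, mem_extChartAt_target p⟩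
    rw [mem_preimage, param_extChartAt_self]
    exact ⟨hp, mem_extChartAt_source p⟩
  have hpos : ∀ z ∈ S, 0 < ENNReal.ofReal (Real.sqrt (gram (localImm m φ p) z).det) := fun z hz =>
    ENNReal.ofReal_pos.2 (Real.sqrt_pos.2 (posDef_gram_localImm hφ hz.2).det_pos)
  have hcont : ContinuousOn (fun z => ENNReal.ofReal (Real.sqrt (gram (localImm m φ p) z).det)) S :=
    fun z hz => (ENNReal.continuous_ofReal.continuousAt.comp
      (continuousAt_sqrt_det_gram hφ hz.2)).continuousWithinAt
  rw [lintegral_eq_zero_iff' (hcont.aemeasurable hSm), Filter.EventuallyEq,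
    ae_restrict_iff' hSm] at h1
  have h2 : volume S = 0 := by
    refine measure_mono_null (fun z hz => ?_) h1
    simp only [mem_compl_iff, mem_ofPred_eq, Pi.zero_apply, not_forall]
    exact ⟨hz, (hpos z hz).ne'⟩
  exact hSo.measure_ne_zero volume hSne h2

/-- Integrals of functions supported in the domain of a chart. -/
theorem integral_riemannianVolume (hφ : IsSmoothIsometricImmersion m φ) {f : M → ℝ}
    (hf : Continuous f) (hsupp : ∀ p, p ∉ (extChartAt (𝓡 m) x₀).source → f p = 0) :
    ∫ p, f p ∂(riemannianVolume m M) = ∫ y in (extChartAt (𝓡 m) x₀).target,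
      Real.sqrt (gram (localImm m φ x₀) y).det * f (param m x₀ y) := by
  rw [← setIntegral_eq_integral_of_forall_compl_eq_zero (s := (extChartAt (𝓡 m) x₀).source)
    (fun p hp => hsupp p hp), riemannianVolume_restrict_source hφ, chartVolume,
    integral_map (aemeasurable_param _) hf.aestronglyMeasurable]
  have hcont : ContinuousOn (fun y => Real.sqrt (metricMatrix m x₀ y).det)
      (extChartAt (𝓡 m) x₀).target := by
    refine ContinuousOn.congr (f := fun y => Real.sqrt (gram (localImm m φ x₀) y).det)
      (fun z hz => (continuousAt_sqrt_det_gram hφ hz).continuousWithinAt) fun z hz => ?_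
    simp only [metricMatrix_eq_gram hφ hz]
  have hm := hcont.aemeasurable (μ := volume) measurableSet_target
  rw [integral_withDensity_eq_integral_toReal_smul₀ hm.ennreal_ofReal
    (Filter.Eventually.of_forall fun _ => ENNReal.ofReal_lt_top)]
  refine setIntegral_congr_fun measurableSet_target fun y hy => ?_
  simp only [metricMatrix_eq_gram hφ hy, ENNReal.toReal_ofReal (Real.sqrt_nonneg _), smul_eq_mul]

end Volume

/-! ### Compactness of closed balls and cut-off functions. -/

section HopfRinow

/-- A metric space in which points have almost-midpoints, as in length spaces. -/
def HasAlmostMidpoints (X : Type*) [EMetricSpace X] : Prop :=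
  ∀ (x z : X) (a b : ℝ≥0∞), a ≠ ⊤ → 0 < b → edist x z < a + b →
    ∃ w, edist x w ≤ a ∧ edist w z < b

/-- Cut a path of length less than `a + b` at a time when its distance from `x` equals `a`. The
first piece has length at least `a`, which leaves less than `b` for the second. -/
theorem hasAlmostMidpoints_of_isRiemannianManifold (m : ℕ) (M : Type*) [EMetricSpace M]
    [ChartedSpace (EuclideanSpace ℝ (Fin m)) M]
    [RiemannianBundle (fun x : M => TangentSpace (𝓡 m) x)] [IsRiemannianManifold (𝓡 m) M] :
    HasAlmostMidpoints M := by
  intro x z a b ha hb h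
  by_cases hxz : edist x z ≤ a
  · exact ⟨z, hxz, by simpa using hb⟩
  rw [IsRiemannianManifold.out (I := 𝓡 m)] at h
  obtain ⟨γ, h0, h1, hγ, hlen⟩ := exists_lt_of_riemannianEDist_lt h
  have hcont : ContinuousOn (fun t => edist x (γ t)) (Icc 0 1) :=
    (continuous_const.edist continuous_id).comp_continuousOn hγ.continuousOn
  have hmem : a ∈ Icc (edist x (γ 0)) (edist x (γ 1)) := by
    rw [h0, h1, edist_self]
    exact ⟨bot_le, (not_le.1 hxz).le⟩
  obtain ⟨t, ht, hta⟩ := intermediate_value_Icc zero_le_one hcont hmem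
  refine ⟨γ t, hta.le, ?_⟩
  have e1 : a ≤ pathELength (𝓡 m) γ 0 t := by
    rw [← hta]
    simp only
    rw [IsRiemannianManifold.out (I := 𝓡 m)]
    exact riemannianEDist_le_pathELength (hγ.mono (Icc_subset_Icc_right ht.2)) h0 rfl ht.1
  have e2 : edist (γ t) z ≤ pathELength (𝓡 m) γ t 1 := by
    rw [IsRiemannianManifold.out (I := 𝓡 m)]
    exact riemannianEDist_le_pathELength (hγ.mono (Icc_subset_Icc_left ht.1)) rfl h1 ht.2
  rw [← pathELength_add ht.1 ht.2] at hlen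
  have e3 : a + edist (γ t) z < a + b := (add_le_add e1 e2).trans_lt hlen
  exact (ENNReal.add_lt_add_iff_left ha).1 e3

variable {X : Type*} [EMetricSpace X]

/-- Almost-midpoints put the ball of radius `r` close to a slightly smaller compact ball, so it is
totally bounded. -/
theorem isCompact_closedEBall_of_forall_sub [CompleteSpace X] (hX : HasAlmostMidpoints X) {x : X}
    {r : ℝ} (h : ∀ δ > 0, IsCompact (Metric.closedEBall x (ENNReal.ofReal (r - δ)))) :
    IsCompact (Metric.closedEBall x (ENNReal.ofReal r)) := by
  refine TotallyBounded.isCompact_of_isClosed ?_ Metric.isClosed_closedEBall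
  refine EMetric.totallyBounded_iff.2 fun ε hε => ?_
  obtain ⟨d, hd0, hdε⟩ := ENNReal.lt_iff_exists_real_btwn.1 (ENNReal.half_pos hε.ne')
  have hd : 0 < d := ENNReal.ofReal_pos.1 (lt_of_le_of_lt bot_le hdε.1)
  obtain ⟨t, ht, hcov⟩ := EMetric.totallyBounded_iff.1 (h (d / 2) (half_pos hd)).totallyBounded
    (ε / 2) (ENNReal.half_pos hε.ne')
  refine ⟨t, ht, fun z hz => ?_⟩
  have h1 : edist x z < ENNReal.ofReal (r - d / 2) + ENNReal.ofReal d := by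
    rw [Metric.mem_closedEBall'] at hz
    refine hz.trans_lt ?_
    -- `ENNReal.ofReal` truncates at zero, so radii `r ≤ 0` do not shrink with `δ` and are treated
    -- apart.
    rcases le_or_gt r 0 with hr | hr
    · rw [ENNReal.ofReal_of_nonpos hr]
      exact (ENNReal.ofReal_pos.2 hd).trans_le le_add_self
    · refine lt_of_lt_of_le ?_ ENNReal.ofReal_add_le
      exact (ENNReal.ofReal_lt_ofReal_iff (by linarith)).2 (by linarith)
  obtain ⟨w, hw1, hw2⟩ := hX x z _ _ ENNReal.ofReal_ne_top (ENNReal.ofReal_pos.2 hd) h1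
  obtain ⟨y, hy, hwy⟩ := mem_iUnion₂.1 (hcov (Metric.mem_closedEBall'.2 hw1))
  refine mem_iUnion₂.2 ⟨y, hy, ?_⟩
  rw [Metric.mem_eball] at hwy ⊢
  calc edist z y ≤ edist z w + edist w y := edist_triangle _ _ _
    _ < ε / 2 + ε / 2 := ENNReal.add_lt_add (by rw [edist_comm]; exact hw2.trans hdε.2) hwy
    _ = ε := ENNReal.add_halves ε

/-- A compact ball has a compact neighbourhood, which contains a `δ`-thickening of it;
almost-midpoints put the ball of radius `r + δ/2` inside that thickening. -/
theorem exists_isCompact_closedEBall_add [LocallyCompactSpace X] (hX : HasAlmostMidpoints X)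
    {x : X} {r : ℝ} (hr : 0 ≤ r) (h : IsCompact (Metric.closedEBall x (ENNReal.ofReal r))) :
    ∃ ε > 0, IsCompact (Metric.closedEBall x (ENNReal.ofReal (r + ε))) := by
  obtain ⟨K, hK, hsub⟩ := exists_compact_superset h
  obtain ⟨δ, hδ, hthick⟩ := h.exists_thickening_subset_open isOpen_interior hsub
  refine ⟨δ / 2, half_pos hδ, hK.of_isClosed_subset Metric.isClosed_closedEBall fun z hz => ?_⟩
  refine interior_subset (hthick ?_)
  have h1 : edist x z < ENNReal.ofReal r + ENNReal.ofReal δ := by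
    rw [Metric.mem_closedEBall'] at hz
    refine hz.trans_lt ?_
    rw [← ENNReal.ofReal_add hr hδ.le]
    exact (ENNReal.ofReal_lt_ofReal_iff (by linarith)).2 (by linarith)
  obtain ⟨w, hw1, hw2⟩ := hX x z _ _ ENNReal.ofReal_ne_top (ENNReal.ofReal_pos.2 hδ) h1
  rw [Metric.mem_thickening_iff_exists_edist_lt]
  exact ⟨w, Metric.mem_closedEBall'.2 hw1, by rwa [edist_comm]⟩

/-- The Hopf–Rinow–Cohn-Vossen theorem: closed balls of finite radius are compact in a complete
locally compact length space. -/
theorem isCompact_closedEBall [LocallyCompactSpace X] [CompleteSpace X]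
    (hX : HasAlmostMidpoints X) (x : X) {R : ℝ} (hR : 0 ≤ R) :
    IsCompact (Metric.closedEBall x (ENNReal.ofReal R)) := by
  set s : Set ℝ := {r | IsCompact (Metric.closedEBall x (ENNReal.ofReal r))} with hs
  have hmono : ∀ {a b : ℝ}, a ≤ b → b ∈ s → a ∈ s := fun hab hb =>
    IsCompact.of_isClosed_subset hb Metric.isClosed_closedEBall
      (Metric.closedEBall_subset_closedEBall (ENNReal.ofReal_le_ofReal hab))
  have h0 : (0 : ℝ) ∈ s := by
    have : Metric.closedEBall x (ENNReal.ofReal 0) = {x} := by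
      ext z
      simp
    rw [hs, mem_ofPred_eq, this]
    exact isCompact_singleton
  -- A continuity argument on `[0, R]`: the set of good radii is closed and reaches beyond each of
  -- its points below `R`.
  have hclosed : IsClosed (s ∩ Icc 0 R) := by
    refine isClosed_of_closure_subset fun r hr => ⟨?_, ?_⟩
    · refine isCompact_closedEBall_of_forall_sub hX fun δ hδ => ?_
      obtain ⟨r', hr', hdist⟩ := Metric.mem_closure_iff.1 hr δ hδ
      rw [Real.dist_eq] at hdist
      exact hmono (by linarith [le_abs_self (r - r')]) hr'.1
    · exact closure_minimal inter_subset_right isClosed_Icc hr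
  have hsub : Icc 0 R ⊆ s := by
    refine hclosed.Icc_subset_of_forall_exists_gt h0 fun r hr b hb => ?_
    obtain ⟨ε, hε, hc⟩ := exists_isCompact_closedEBall_add hX hr.2.1 hr.1
    refine ⟨min b (r + ε), hmono (min_le_right _ _) hc, ?_, min_le_left _ _⟩
    exact lt_min hb (by linarith)
  exact hsub ⟨hR, le_rfl⟩

/-- Lipschitz cut-off functions with compact support and small Lipschitz constant. -/
theorem exists_lipschitzWith_cutoff [LocallyCompactSpace X] [CompleteSpace X]
    (hX : HasAlmostMidpoints X) (x : X) {R : ℝ} (hR : 0 < R) :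
    ∃ η : X → ℝ, LipschitzWith R.toNNReal⁻¹ η ∧ HasCompactSupport η ∧ (∀ p, 0 ≤ η p) ∧
      (∀ p, η p ≤ 1) ∧ ∀ p ∈ Metric.eball x 1, η p = 1 := by
  -- The function `max(0, 1 - d(p, B)/R)` for the unit ball `B`. It vanishes outside the ball of
  -- radius `R + 1`, in particular at points infinitely far from `x`.
  refine ⟨fun p => (thickenedIndicator hR (Metric.eball x 1) p : ℝ), ?_, ?_, ?_, ?_, ?_⟩
  · intro p q
    exact lipschitzWith_thickenedIndicator hR (Metric.eball x 1) p q
  · refine HasCompactSupport.intro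
      (isCompact_closedEBall hX x (R := R + 1) (by linarith)) fun p hp => ?_
    have : p ∉ Metric.thickening R (Metric.eball x 1) := by
      intro h
      apply hp
      obtain ⟨w, hw, hpw⟩ := (Metric.mem_thickening_iff_exists_edist_lt _ _).1 h
      rw [Metric.mem_closedEBall, ENNReal.ofReal_add hR.le zero_le_one, ENNReal.ofReal_one]
      exact (edist_triangle p w x).trans (add_le_add hpw.le (Metric.mem_eball.1 hw).le)
    rw [thickenedIndicator_zero hR _ this]
    rfl
  · exact fun p => NNReal.coe_nonneg _
  · exact fun p => thickenedIndicator_le_one hR _ p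
  · intro p hp
    simp only [thickenedIndicator_one hR _ hp, NNReal.coe_one]

end HopfRinow

/-! ### Lipschitz functions on the manifold read in charts. -/

section ChartLipschitz

variable {m n : ℕ} {r : ℝ} {M : Type*} [EMetricSpace M]
  [ChartedSpace (EuclideanSpace ℝ (Fin m)) M] [IsManifold (𝓡 m) ∞ M]
  [RiemannianBundle (fun x : M => TangentSpace (𝓡 m) x)]
  [IsRiemannianManifold (𝓡 m) M]
  {φ : M → Metric.sphere (0 : EuclideanSpace ℝ (Fin (n + 1))) r} {x₀ : M}
  {y z : EuclideanSpace ℝ (Fin m)} {η : M → ℝ} {L : ℝ≥0}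

/-- The distance between two points of a chart is at most the length of the coordinate segment. -/
theorem edist_param_le (hφ : IsSmoothIsometricImmersion m φ)
    (hseg : segment ℝ y z ⊆ (extChartAt (𝓡 m) x₀).target) {C : ℝ}
    (hC : ∀ w ∈ segment ℝ y z, ‖fderiv ℝ (localImm m φ x₀) w (z - y)‖ ≤ C) :
    edist (param m x₀ y) (param m x₀ z) ≤ ENNReal.ofReal C := by
  set l : ℝ → EuclideanSpace ℝ (Fin m) := fun t => AffineMap.lineMap y z t with hl
  have hlmem : ∀ t ∈ Icc (0 : ℝ) 1, l t ∈ segment ℝ y z := fun t ht => by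
    rw [segment_eq_image_lineMap]
    exact ⟨t, ht, rfl⟩
  have hld : ∀ t, HasDerivAt l (z - y) t := fun t => AffineMap.hasDerivAt_lineMap
  have hlc : ContDiff ℝ 1 l := by
    rw [hl]
    simp only [AffineMap.lineMap_apply_module]
    fun_prop
  have hγ : ContMDiffOn 𝓘(ℝ, ℝ) (𝓡 m) 1 (param m x₀ ∘ l) (Icc 0 1) := fun t ht =>
    (((contMDiffAt_param (hseg (hlmem t ht))).of_le (by norm_cast)).comp t
      (contMDiffAt_iff_contDiffAt.2 hlc.contDiffAt)).contMDiffWithinAt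
  rw [IsRiemannianManifold.out (I := 𝓡 m)]
  refine (riemannianEDist_le_pathELength hγ (by simp [hl]) (by simp [hl]) zero_le_one).trans ?_
  rw [pathELength_eq_lintegral_mfderiv_Icc]
  have hbound : ∀ t ∈ Icc (0 : ℝ) 1,
      ‖mfderiv 𝓘(ℝ, ℝ) (𝓡 m) (param m x₀ ∘ l) t 1‖ₑ ≤ ENNReal.ofReal C := by
    intro t ht
    have h1 : mfderiv 𝓘(ℝ, ℝ) (𝓡 m) (param m x₀ ∘ l) t 1
        = mfderiv (𝓡 m) (𝓡 m) (param m x₀) (l t) (z - y) := by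
      have h2 := mfderiv_comp_apply (I := 𝓘(ℝ, ℝ)) (I' := 𝓡 m) (I'' := 𝓡 m) t
        (mdifferentiableAt_param (hseg (hlmem t ht)))
        (mdifferentiableAt_iff_differentiableAt.2 (hld t).differentiableAt) (1 : ℝ)
      refine h2.trans ?_
      have h3 : mfderiv 𝓘(ℝ, ℝ) (𝓡 m) l t (1 : ℝ) = z - y := by
        rw [mfderiv_eq_fderiv]
        exact (hld t).hasFDerivAt.fderiv ▸ one_smul ℝ (z - y)
      exact congrArg _ h3
    rw [h1, ← ofReal_norm, norm_mfderiv_param hφ (hseg (hlmem t ht))]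
    exact ENNReal.ofReal_le_ofReal (hC _ (hlmem t ht))
  refine (setLIntegral_mono' measurableSet_Icc hbound).trans ?_
  rw [setLIntegral_const, Real.volume_Icc]
  simp

theorem abs_sub_comp_param_le (hφ : IsSmoothIsometricImmersion m φ) (hη : LipschitzWith L η)
    (hseg : segment ℝ y z ⊆ (extChartAt (𝓡 m) x₀).target) {C : ℝ} (hC0 : 0 ≤ C)
    (hC : ∀ w ∈ segment ℝ y z, ‖fderiv ℝ (localImm m φ x₀) w (z - y)‖ ≤ C) :
    |η (param m x₀ z) - η (param m x₀ y)| ≤ L * C := by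
  have h1 := (hη (param m x₀ y) (param m x₀ z)).trans
    (mul_le_mul_right (edist_param_le hφ hseg hC) (L : ℝ≥0∞))
  rw [edist_dist, Real.dist_eq, abs_sub_comm, ← ENNReal.ofReal_coe_nnreal,
    ← ENNReal.ofReal_mul L.coe_nonneg] at h1
  exact (ENNReal.ofReal_le_ofReal_iff (mul_nonneg L.coe_nonneg hC0)).1 h1

/-- A local bound on `dΦ` compares Riemannian with Euclidean distance, which makes Rademacher's
theorem available in charts. -/
theorem locallyLipschitzOn_comp_param (hφ : IsSmoothIsometricImmersion m φ)
    (hη : LipschitzWith L η) :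
    LocallyLipschitzOn (extChartAt (𝓡 m) x₀).target (η ∘ param m x₀) := by
  intro y hy
  have hc : ContinuousAt (fun w => ‖fderiv ℝ (localImm m φ x₀) w‖) y :=
    (((contDiffAt_localImm hφ hy).fderiv_right (m := ∞) (by simp)).continuousAt).norm
  have h1 := Filter.Eventually.and ((isOpen_extChartAt_target x₀).mem_nhds hy)
    (hc.eventually_lt_const (lt_add_one _))
  obtain ⟨ε, hε, hball⟩ := Metric.eventually_nhds_iff_ball.1 h1
  set C : ℝ≥0 := ⟨‖fderiv ℝ (localImm m φ x₀) y‖ + 1, by positivity⟩ with hC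
  refine ⟨L * C, Metric.ball y ε, mem_nhdsWithin_of_mem_nhds (Metric.ball_mem_nhds y hε), ?_⟩
  refine LipschitzOnWith.of_dist_le_mul fun a ha b hb => ?_
  have hsegb : segment ℝ b a ⊆ Metric.ball y ε := (convex_ball y ε).segment_subset hb ha
  have h2 := abs_sub_comp_param_le hφ hη (y := b) (z := a) (x₀ := x₀) (C := C * ‖a - b‖)
    (fun w hw => (hball w (hsegb hw)).1) (by positivity) fun w hw =>
      (ContinuousLinearMap.le_opNorm _ _).trans
        (mul_le_mul_of_nonneg_right (hball w (hsegb hw)).2.le (norm_nonneg _))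
  rw [Real.dist_eq, dist_eq_norm, NNReal.coe_mul, mul_assoc]
  exact h2

/-- The gradient of an `L`-Lipschitz function has norm at most `L`. -/
theorem abs_fderiv_comp_param_le (hφ : IsSmoothIsometricImmersion m φ) (hη : LipschitzWith L η)
    (hy : y ∈ (extChartAt (𝓡 m) x₀).target) (hd : DifferentiableAt ℝ (η ∘ param m x₀) y)
    (v : EuclideanSpace ℝ (Fin m)) :
    |fderiv ℝ (η ∘ param m x₀) y v| ≤ L * ‖fderiv ℝ (localImm m φ x₀) y v‖ := by
  have hc : ContinuousAt (fun w => ‖fderiv ℝ (localImm m φ x₀) w v‖) y :=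
    (((contDiffAt_localImm hφ hy).fderiv_right (m := ∞) (by simp)).continuousAt.clm_apply
      continuousAt_const).norm
  refine le_of_forall_pos_le_add fun ε hε => ?_
  -- The slack `δ` absorbs the variation of `‖dΦ v‖` along a short segment; dividing by `L + 1` also
  -- covers `L = 0`.
  obtain ⟨δ, hδ, hδL⟩ : ∃ δ > 0, L * δ ≤ ε := by
    refine ⟨ε / (L + 1), by positivity, ?_⟩
    rw [mul_div_assoc', div_le_iff₀ (by positivity)]
    nlinarith [L.coe_nonneg]
  set C := ‖fderiv ℝ (localImm m φ x₀) y v‖ + δ with hC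
  have hCnn : 0 ≤ C := by positivity
  have h1 := Filter.Eventually.and ((isOpen_extChartAt_target x₀).mem_nhds hy)
    (hc.eventually_lt_const (lt_add_of_pos_right _ hδ))
  obtain ⟨ρ, hρ, hball⟩ := Metric.eventually_nhds_iff_ball.1 h1
  have hline : HasDerivAt (fun t : ℝ => y + t • v) v 0 := by
    simpa using ((hasDerivAt_id (0 : ℝ)).smul_const v).const_add y
  have hd' : HasFDerivAt (η ∘ param m x₀) (fderiv ℝ (η ∘ param m x₀) y) (y + (0 : ℝ) • v) := by
    simpa using hd.hasFDerivAt
  have h2 := hd'.comp_hasDerivAt (0 : ℝ) hline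
  have h3 : ∀ᶠ t in nhds (0 : ℝ), y + t • v ∈ Metric.ball y ρ := by
    have : ContinuousAt (fun t : ℝ => y + t • v) 0 := hline.continuousAt
    exact this.eventually_mem (by simpa using Metric.ball_mem_nhds y hρ)
  have h4 : |fderiv ℝ (η ∘ param m x₀) y v| ≤ L * C := by
    refine h2.le_of_lip' (mul_nonneg L.coe_nonneg hCnn) (h3.mono fun t ht => ?_)
    have hseg : segment ℝ y (y + t • v) ⊆ Metric.ball y ρ :=
      (convex_ball y ρ).segment_subset (Metric.mem_ball_self hρ) ht
    have h5 := abs_sub_comp_param_le hφ hη (y := y) (z := y + t • v) (x₀ := x₀) (C := |t| * C)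
      (fun w hw => (hball w (hseg hw)).1) (by positivity) fun w hw => by
        rw [add_sub_cancel_left, map_smul, norm_smul, Real.norm_eq_abs]
        exact mul_le_mul_of_nonneg_left (hball w (hseg hw)).2.le (abs_nonneg _)
    simp only [Function.comp_apply, zero_smul, add_zero, sub_zero, Real.norm_eq_abs]
    refine h5.trans_eq ?_
    ring
  calc _ ≤ L * C := h4
    _ = L * ‖fderiv ℝ (localImm m φ x₀) y v‖ + L * δ := by rw [hC, mul_add]
    _ ≤ _ := by linarith

end ChartLipschitz

/-! ### Green's formula in coordinates for Lipschitz test functions. -/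

section IntegrationByParts

variable {m : ℕ} {T K : Set (EuclideanSpace ℝ (Fin m))} {h : EuclideanSpace ℝ (Fin m) → ℝ}

/-- On a compact neighbourhood `K'` of `K` compactness gives a constant. A point of `K` and one
outside `K'` are at least `δ` apart, so there `sup |h| / δ` serves. -/
theorem exists_lipschitzWith_of_locallyLipschitzOn (hT : IsOpen T) (hK : IsCompact K)
    (hKT : K ⊆ T) (hloc : LocallyLipschitzOn T h) (h0 : ∀ y ∉ K, h y = 0) :
    ∃ D : ℝ≥0, LipschitzWith D h := by
  obtain ⟨K', hK', hKK', hK'T⟩ := exists_compact_between hK hT hKT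
  obtain ⟨δ, hδ, hthick⟩ := hK.exists_thickening_subset_open isOpen_interior hKK'
  obtain ⟨D, hD⟩ := LocallyLipschitzOn.exists_lipschitzOnWith_of_compact hK' (hloc.mono hK'T)
  obtain ⟨B, hB⟩ := hK.exists_bound_of_continuousOn (hloc.continuousOn.mono hKT)
  have hB' : ∀ y, |h y| ≤ max B 0 := fun y => by
    by_cases hy : y ∈ K
    · exact (hB y hy).trans (le_max_left _ _)
    · rw [h0 y hy, abs_zero]
      exact le_max_right _ _
  set D' : ℝ≥0 := ⟨max B 0 / δ, by positivity⟩ with hD'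
  have hfar : ∀ x y, x ∈ K → y ∉ K' → |h x - h y| ≤ D' * dist x y := by
    intro x y hx hy
    rw [h0 y fun hyK => hy (interior_subset (hKK' hyK)), sub_zero]
    have h1 : δ ≤ dist x y := by
      by_contra hlt
      refine hy (interior_subset (hthick (Metric.mem_thickening_iff.2 ⟨x, hx, ?_⟩)))
      rw [dist_comm]
      exact not_le.1 hlt
    calc |h x| ≤ max B 0 := hB' x
      _ = max B 0 / δ * δ := by field_simp
      _ ≤ D' * dist x y := mul_le_mul_of_nonneg_left h1 D'.coe_nonneg
  refine ⟨D + D', LipschitzWith.of_dist_le_mul fun x y => ?_⟩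
  have e1 : (D : ℝ) * dist x y ≤ ((D + D' : ℝ≥0) : ℝ) * dist x y :=
    mul_le_mul_of_nonneg_right (by simp) dist_nonneg
  have e2 : (D' : ℝ) * dist x y ≤ ((D + D' : ℝ≥0) : ℝ) * dist x y :=
    mul_le_mul_of_nonneg_right (by simp) dist_nonneg
  by_cases hx : x ∈ K' <;> by_cases hy : y ∈ K'
  · exact (hD.dist_le_mul x hx y hy).trans e1
  · by_cases hxK : x ∈ K
    · exact (hfar x y hxK hy).trans e2
    · rw [h0 x hxK, h0 y fun hyK => hy (interior_subset (hKK' hyK)), dist_self]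
      positivity
  · by_cases hyK : y ∈ K
    · rw [dist_comm, dist_comm x] at *
      exact (hfar y x hyK hx).trans e2
    · rw [h0 y hyK, h0 x fun hxK => hx (interior_subset (hKK' hxK)), dist_self]
      positivity
  · rw [h0 x fun hxK => hx (interior_subset (hKK' hxK)),
      h0 y fun hyK => hy (interior_subset (hKK' hyK)), dist_self]
    positivity

theorem integrable_of_continuousOn_of_eq_zero {f : EuclideanSpace ℝ (Fin m) → ℝ}
    (hK : IsCompact K) (hf : ContinuousOn f K) (h0 : ∀ y ∉ K, f y = 0) : Integrable f :=
  (hf.integrableOn_compact hK).integrable_of_forall_notMem_eq_zero h0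

/-- Integration by parts for a compactly supported Lipschitz function and a function that is
smooth on a neighbourhood of its support. -/
theorem integral_partialD_mul_eq (hT : IsOpen T) (hK : IsCompact K) (hKT : K ⊆ T) {D : ℝ≥0}
    (hD : LipschitzWith D h) (h0 : ∀ y ∉ K, h y = 0) {X : EuclideanSpace ℝ (Fin m) → ℝ}
    (hX : ∀ y ∈ T, ContDiffAt ℝ ∞ X y) (i : Fin m) :
    Integrable (fun y => partialD i X y * h y) ∧ Integrable (fun y => partialD i h y * X y) ∧
      ∫ y, partialD i X y * h y = -∫ y, partialD i h y * X y := by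
  obtain ⟨K', hK', hKK', hK'T⟩ := exists_compact_between hK hT hKT
  -- Multiplying by `χ` makes `X` smooth with compact support on the whole space without changing it
  -- near `K`, where `h` lives.
  obtain ⟨χ, hχ1, hχ0, -⟩ := exists_contMDiffMap_one_nhds_of_subset_interior
    (n := (⊤ : ℕ∞)) 𝓘(ℝ, EuclideanSpace ℝ (Fin m)) hK.isClosed hKK'
  have hχs : ContDiff ℝ ∞ χ := contMDiff_iff_contDiff.1 χ.contMDiff
  have hχ1' : ∀ y ∈ K, ∀ᶠ z in nhds y, χ z = 1 := eventually_nhdsSet_iff_forall.1 hχ1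
  set Y : EuclideanSpace ℝ (Fin m) → ℝ := fun y => χ y * X y with hY
  have hYs : ContDiff ℝ ∞ Y := by
    refine contDiff_iff_contDiffAt.2 fun y => ?_
    by_cases hy : y ∈ T
    · exact hχs.contDiffAt.mul (hX y hy)
    · have : Y =ᶠ[nhds y] fun _ => 0 := by
        filter_upwards [hK'.isClosed.isOpen_compl.mem_nhds fun hyK => hy (hK'T hyK)] with z hz
        simp only [hY, hχ0 z hz, zero_mul]
      exact contDiffAt_const.congr_of_eventuallyEq this
  have hYc : HasCompactSupport Y := HasCompactSupport.intro hK' fun y hy => by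
    simp only [hY, hχ0 y hy, zero_mul]
  obtain ⟨C, hC⟩ := hYs.lipschitzWith_of_hasCompactSupport hYc (by simp)
  have hc : HasCompactSupport h := HasCompactSupport.intro hK h0
  have hYX : ∀ y ∈ K, Y =ᶠ[nhds y] X := fun y hy => (hχ1' y hy).mono fun z hz => by
    simp only [hY, hz, one_mul]
  have hdh : ∀ y ∉ K, fderiv ℝ h y = 0 := by
    intro y hy
    have : h =ᶠ[nhds y] fun _ => 0 := by
      filter_upwards [hK.isClosed.isOpen_compl.mem_nhds hy] with z hz using h0 z hz
    rw [this.fderiv_eq]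
    simp
  have e1 : ∀ y, lineDeriv ℝ Y y (EuclideanSpace.single i 1) * h y = partialD i X y * h y := by
    intro y
    by_cases hy : y ∈ K
    · rw [(hYs.differentiable (by simp) y).lineDeriv_eq_fderiv]
      exact congrArg (· * h y) (partialD_congr (hYX y hy) i)
    · rw [h0 y hy, mul_zero, mul_zero]
  have e2' : ∀ y, partialD i h y * Y y = partialD i h y * X y := by
    intro y
    by_cases hy : y ∈ K
    · rw [(hYX y hy).eq_of_nhds]
    · rw [partialD, hdh y hy]
      simp
  have e2 : (fun y => lineDeriv ℝ h y (-EuclideanSpace.single i 1) * Y y)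
      =ᵐ[volume] fun y => -(partialD i h y * X y) := by
    filter_upwards [hD.ae_differentiableAt] with y hy
    rw [hy.lineDeriv_eq_fderiv, map_neg, neg_mul, ← e2']
    rfl
  refine ⟨?_, ?_, ?_⟩
  · refine integrable_of_continuousOn_of_eq_zero hK (ContinuousOn.mul (fun y hy => ?_)
      hD.continuous.continuousOn) fun y hy => by rw [h0 y hy, mul_zero]
    exact (contDiffAt_partialD (hX y (hKT hy)) i).continuousAt.continuousWithinAt
  · simp only [← e2']
    refine (hYs.continuous.integrable_of_hasCompactSupport hYc).bdd_mul (c := D)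
      (measurable_fderiv_apply_const ℝ h _).aestronglyMeasurable
      (Filter.Eventually.of_forall fun y => ?_)
    refine ((fderiv ℝ h y).le_opNorm _).trans ?_
    simpa using norm_fderiv_le_of_lipschitz ℝ hD
  · rw [← integral_neg, ← integral_congr_ae e2, ← LipschitzWith.integral_lineDeriv_mul_eq hC hD hc]
    exact integral_congr_ae (Filter.Eventually.of_forall fun y => (e1 y).symm)

/-- Green's formula in coordinates. -/
theorem integral_mul_lap_eq {F : Type*} [NormedAddCommGroup F] [InnerProductSpace ℝ F]
    {Φ : EuclideanSpace ℝ (Fin m) → F} {u : EuclideanSpace ℝ (Fin m) → ℝ}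
    (hT : IsOpen T) (hK : IsCompact K) (hKT : K ⊆ T) {D : ℝ≥0}
    (hD : LipschitzWith D h) (h0 : ∀ y ∉ K, h y = 0)
    (hΦ : ∀ y ∈ T, ContDiffAt ℝ ∞ Φ y) (hdet : ∀ y ∈ T, 0 < (gram Φ y).det)
    (hu : ∀ y ∈ T, ContDiffAt ℝ ∞ u y) :
    Integrable (fun y => Real.sqrt (gram Φ y).det *
      ∑ i, (∑ j, (gram Φ y)⁻¹ i j * partialD j u y) * partialD i h y) ∧
    ∫ y, Real.sqrt (gram Φ y).det * (h y * lap (gram Φ) u y)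
      = -∫ y, Real.sqrt (gram Φ y).det *
        ∑ i, (∑ j, (gram Φ y)⁻¹ i j * partialD j u y) * partialD i h y := by
  set X : Fin m → EuclideanSpace ℝ (Fin m) → ℝ := fun i y =>
    Real.sqrt (gram Φ y).det * ∑ j, (gram Φ y)⁻¹ i j * partialD j u y with hXdef
  have hX : ∀ i, ∀ y ∈ T, ContDiffAt ℝ ∞ (X i) y := by
    intro i y hy
    have hg := fun a b => contDiffAt_gram (hΦ y hy) a b
    have h1 : ContDiffAt ℝ ∞ (fun z => Real.sqrt (gram Φ z).det) y :=
      (contDiffAt_det hg).sqrt (hdet y hy).ne'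
    exact h1.mul (ContDiffAt.sum fun j _ =>
      (contDiffAt_matrix_inv hg (hdet y hy).ne' i j).mul (contDiffAt_partialD (hu y hy) j))
  have hparts := fun i => integral_partialD_mul_eq hT hK hKT hD h0 (hX i) i
  have e1 : ∀ y, ∑ i, partialD i (X i) y * h y
      = Real.sqrt (gram Φ y).det * (h y * lap (gram Φ) u y) := by
    intro y
    by_cases hy : y ∈ K
    · rw [← Finset.sum_mul, sum_partialD_sqrt_det_mul (contDiffAt_gram (hΦ y (hKT hy)))
        (gram_comm Φ) (hdet y (hKT hy)) (hu y (hKT hy))]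
      ring
    · simp [h0 y hy]
  have e2 : ∀ y, ∑ i, partialD i h y * X i y = Real.sqrt (gram Φ y).det *
      ∑ i, (∑ j, (gram Φ y)⁻¹ i j * partialD j u y) * partialD i h y := by
    intro y
    rw [Finset.mul_sum]
    exact Finset.sum_congr rfl fun i _ => by simp only [hXdef]; ring
  simp only [← e1, ← e2]
  refine ⟨integrable_finsetSum _ fun i _ => (hparts i).2.1, ?_⟩
  rw [integral_finsetSum _ fun i _ => (hparts i).1, integral_finsetSum _ fun i _ => (hparts i).2.1,
    ← Finset.sum_neg_distrib]
  exact Finset.sum_congr rfl fun i _ => (hparts i).2.2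

/-- A locally Lipschitz function on an open set is differentiable almost everywhere. -/
theorem ae_differentiableAt_of_locallyLipschitzOn (hT : IsOpen T) (hloc : LocallyLipschitzOn T h) :
    ∀ᵐ y, y ∈ T → DifferentiableAt ℝ h y := by
  rw [ae_iff]
  refine measure_null_of_locally_null _ fun y hy => ?_
  simp only [mem_ofPred_eq, Classical.not_imp] at hy
  obtain ⟨C, t, ht, hC⟩ := hloc hy.1
  rw [hT.nhdsWithin_eq hy.1] at ht
  obtain ⟨U, hUt, hU, hyU⟩ := mem_nhds_iff.1 ht
  have h1 := (hC.mono hUt).ae_differentiableWithinAt_of_mem (μ := volume)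
  rw [ae_iff] at h1
  refine ⟨_, ?_, h1⟩
  filter_upwards [self_mem_nhdsWithin, mem_nhdsWithin_of_mem_nhds (hU.mem_nhds hyU)] with z hz hzU
  simp only [Classical.not_imp] at hz ⊢
  exact ⟨hzU, fun hd => hz.2 (hd.differentiableAt (hU.mem_nhds hzU))⟩

end IntegrationByParts

/-! ### Products of locally Lipschitz functions. -/

section LocallyLipschitz

theorem locallyLipschitzOn_mul {X : Type*} [PseudoEMetricSpace X] {s : Set X} {f h : X → ℝ}
    (hf : LocallyLipschitzOn s f) (hh : LocallyLipschitzOn s h) :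
    LocallyLipschitzOn s fun x => f x * h x := by
  intro x hx
  obtain ⟨A, a, ha, hA⟩ := hf hx
  obtain ⟨B, b, hb, hB⟩ := hh hx
  obtain ⟨C, c, hc, hC⟩ := (contDiff_mul (𝕜 := ℝ) (𝔸 := ℝ) (n := 1)).contDiffAt.exists_lipschitzOnWith
    (x := (f x, h x))
  have hcont : ContinuousWithinAt (fun z => (f z, h z)) s x :=
    (hf.continuousOn x hx).prodMk (hh.continuousOn x hx)
  refine ⟨C * max A B, a ∩ b ∩ (fun z => (f z, h z)) ⁻¹' c,
    Filter.inter_mem (Filter.inter_mem ha hb) (hcont hc), ?_⟩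
  have h1 : LipschitzOnWith (max A B) (fun z => (f z, h z))
      (a ∩ b ∩ (fun z => (f z, h z)) ⁻¹' c) :=
    (hA.mono fun z hz => hz.1.1).prodMk (hB.mono fun z hz => hz.1.2)
  exact hC.comp h1 fun z hz => hz.2

theorem locallyLipschitzOn_of_contDiffAt {E : Type*} [NormedAddCommGroup E] [NormedSpace ℝ E]
    {s : Set E} {f : E → ℝ} (hf : ∀ y ∈ s, ContDiffAt ℝ ∞ f y) : LocallyLipschitzOn s f := by
  intro y hy
  obtain ⟨C, t, ht, hC⟩ := ((hf y hy).of_le (by norm_cast) :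
    ContDiffAt ℝ 1 f y).exists_lipschitzOnWith
  exact ⟨C, t, mem_nhdsWithin_of_mem_nhds ht, hC⟩

end LocallyLipschitz

/-! ### The pointwise inequality behind the Caccioppoli estimate. -/

section Pointwise

variable {m : ℕ} {F V : Type*} [NormedAddCommGroup F] [InnerProductSpace ℝ F]
  [NormedAddCommGroup V] [InnerProductSpace ℝ V]
  {Φ : EuclideanSpace ℝ (Fin m) → F} {f : EuclideanSpace ℝ (Fin m) → V}
  {ρ η : EuclideanSpace ℝ (Fin m) → ℝ} {y : EuclideanSpace ℝ (Fin m)} {L : ℝ}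

/-- Product rule for `ρη²`, then Cauchy–Schwarz and Young on the term with `dη`. The term with `dρ`
is kept exactly, as it cancels when summed over a partition of unity. -/
theorem neg_sum_gradient_mul_le (hpos : (gram Φ y).PosDef) (hf : DifferentiableAt ℝ f y)
    (hρ : DifferentiableAt ℝ ρ y) (hη : DifferentiableAt ℝ η y) (hρ0 : 0 ≤ ρ y) (hη0 : 0 ≤ η y)
    (hL : 0 ≤ L) (hD : ∀ v, |fderiv ℝ η y v| ≤ L * ‖fderiv ℝ Φ y v‖) :
    -∑ i, (∑ j, (gram Φ y)⁻¹ i j * partialD j (fun z => inner ℝ (f z) (f z)) y)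
        * partialD i (fun z => ρ z * (η z * η z)) y
      ≤ -(η y ^ 2 * gradInner (gram Φ) ρ (fun z => inner ℝ (f z) (f z)) y)
        + ρ y * (η y ^ 2 * gradInner (gram Φ) f f y + 4 * L ^ 2 * inner ℝ (f y) (f y)) := by
  set u : EuclideanSpace ℝ (Fin m) → ℝ := fun z => inner ℝ (f z) (f z) with hu
  set c : Fin m → ℝ := fun i => ∑ j, (gram Φ y)⁻¹ i j * partialD j u y with hc
  have h1 : ∀ i, partialD i (fun z => ρ z * (η z * η z)) y
      = η y ^ 2 * partialD i ρ y + 2 * ρ y * η y * partialD i η y := by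
    intro i
    have := (hρ.hasFDerivAt.fun_mul (hη.hasFDerivAt.fun_mul hη.hasFDerivAt)).fderiv
    rw [partialD, this]
    simp only [partialD, _root_.add_apply, _root_.smul_apply, smul_eq_mul]
    ring
  have h2 : ∑ i, c i * partialD i (fun z => ρ z * (η z * η z)) y
      = η y ^ 2 * gradInner (gram Φ) ρ u y + 2 * ρ y * η y * ∑ i, c i * partialD i η y := by
    simp only [h1, gradInner, Finset.mul_sum, ← Finset.sum_add_distrib]
    refine Finset.sum_congr rfl fun i _ => ?_
    have e : ∑ j, η y ^ 2 * ((gram Φ y)⁻¹ i j * inner ℝ (partialD i ρ y) (partialD j u y))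
        = η y ^ 2 * partialD i ρ y * c i := by
      rw [hc, Finset.mul_sum]
      refine Finset.sum_congr rfl fun j _ => ?_
      simp only [RCLike.inner_apply, conj_trivial]
      ring
    rw [e]
    ring
  have h3 := abs_sum_inv_gram_mul_le (u := u) hpos.det_pos.ne' hD
  have h4 := gradInner_inner_self_le hpos hf
  have ha : (0 : ℝ) ≤ u y := real_inner_self_nonneg
  have he := gradInner_self_nonneg hpos f
  set a := u y with hadef
  set e := gradInner (gram Φ) f f y with hedef
  have h5 : Real.sqrt (gradInner (gram Φ) u u y) ≤ 2 * (Real.sqrt a * Real.sqrt e) := by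
    rw [Real.sqrt_le_left (by positivity), mul_pow, mul_pow, Real.sq_sqrt ha, Real.sq_sqrt he]
    linarith
  have h6 : |∑ i, c i * partialD i η y| ≤ L * (2 * (Real.sqrt a * Real.sqrt e)) :=
    h3.trans (mul_le_mul_of_nonneg_left h5 hL)
  have h7 : η y * -(∑ i, c i * partialD i η y) ≤ η y * (L * (2 * (Real.sqrt a * Real.sqrt e))) :=
    mul_le_mul_of_nonneg_left ((neg_le_abs _).trans h6) hη0
  have h8 : 2 * (η y * -(∑ i, c i * partialD i η y)) ≤ η y ^ 2 * e + 4 * L ^ 2 * a := by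
    -- Young's inequality, weighted so that `|df|²` gets coefficient exactly `η²`; this fixes the
    -- constant `4 L²`.
    have h9 := sq_nonneg (η y * Real.sqrt e - 2 * L * Real.sqrt a)
    have e1 := Real.sq_sqrt ha
    have e2 := Real.sq_sqrt he
    have : (η y * Real.sqrt e - 2 * L * Real.sqrt a) ^ 2
      = η y ^ 2 * (Real.sqrt e) ^ 2 + 4 * L ^ 2 * (Real.sqrt a) ^ 2
        - 2 * (η y * (L * (2 * (Real.sqrt a * Real.sqrt e)))) := by ring
    rw [this, e1, e2] at h9
    linarith
  have h10 := mul_le_mul_of_nonneg_left h8 hρ0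
  rw [h2]
  linarith

end Pointwise

/-! ### Gradient pairings and smoothness on the manifold. -/

section Chart

variable {m n : ℕ} {r : ℝ} {M : Type*} [TopologicalSpace M]
  [ChartedSpace (EuclideanSpace ℝ (Fin m)) M]
  {φ : M → Metric.sphere (0 : EuclideanSpace ℝ (Fin (n + 1))) r}
  {V : Type*} [NormedAddCommGroup V] [InnerProductSpace ℝ V]

theorem manifoldGradInner_eq_zero_of_eventually_const {ρ h : M → ℝ} {p : M} {c : ℝ}
    (hρ : ∀ᶠ q in nhds p, ρ q = c) : manifoldGradInner m φ ρ h p = 0 := by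
  have h1 : (ρ ∘ param m p) =ᶠ[nhds (extChartAt (𝓡 m) p p)] fun _ => c := by
    have hc : Filter.Tendsto (param m p) (nhds (extChartAt (𝓡 m) p p)) (nhds p) := by
      have := continuousAt_extChartAt_symm (I := 𝓡 m) p
      rwa [ContinuousAt, (extChartAt (𝓡 m) p).left_inv (mem_extChartAt_source p)] at this
    exact hc.eventually hρ
  have h2 : ∀ i, partialD i (ρ ∘ param m p) (extChartAt (𝓡 m) p p) = 0 := fun i => by
    rw [partialD_congr h1 i]
    simp [partialD]
  simp only [manifoldGradInner, gradInner, h2, inner_zero_left, mul_zero, Finset.sum_const_zero]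

variable [IsManifold (𝓡 m) ∞ M]

theorem sum_manifoldGradInner {ι : Type*} (J : Finset ι) {ρ : ι → M → ℝ} {h : M → ℝ}
    (hρ : ∀ j, ContMDiff (𝓡 m) 𝓘(ℝ, ℝ) ∞ (ρ j)) (p : M) :
    ∑ j ∈ J, manifoldGradInner m φ (ρ j) h p
      = manifoldGradInner m φ (fun q => ∑ j ∈ J, ρ j q) h p := by
  have hd : ∀ j, DifferentiableAt ℝ (ρ j ∘ param m p) (extChartAt (𝓡 m) p p) := fun j =>
    (contDiffAt_comp_param (hρ j) (mem_extChartAt_target p)).differentiableAt_of_infty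
  have h1 : ∀ i, partialD i ((fun q => ∑ j ∈ J, ρ j q) ∘ param m p) (extChartAt (𝓡 m) p p)
      = ∑ j ∈ J, partialD i (ρ j ∘ param m p) (extChartAt (𝓡 m) p p) := by
    intro i
    have := fderiv_fun_sum (u := J) fun j _ => hd j
    simp only [partialD]
    rw [← _root_.sum_apply]
    exact congrFun (congrArg DFunLike.coe this) _
  simp only [manifoldGradInner, gradInner, h1, sum_inner, Finset.mul_sum]
  rw [Finset.sum_comm]
  refine Finset.sum_congr rfl fun i _ => ?_
  rw [Finset.sum_comm]

theorem contMDiff_inner_self {f : M → V} (hf : ContMDiff (𝓡 m) 𝓘(ℝ, V) ∞ f) :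
    ContMDiff (𝓡 m) 𝓘(ℝ, ℝ) ∞ fun p => (inner ℝ (f p) (f p) : ℝ) :=
  contMDiff_of_comp_param fun _ _ hy =>
    (contDiffAt_comp_param hf hy).inner ℝ (contDiffAt_comp_param hf hy)

variable [RiemannianBundle (fun x : M => TangentSpace (𝓡 m) x)]

theorem manifoldGradInner_self_nonneg (hφ : IsSmoothIsometricImmersion m φ) (f : M → V) (p : M) :
    0 ≤ manifoldGradInner m φ f f p :=
  gradInner_self_nonneg (posDef_gram_localImm hφ (mem_extChartAt_target (I := 𝓡 m) p)) _

theorem contMDiff_manifoldLap (hφ : IsSmoothIsometricImmersion m φ) {f : M → V}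
    (hf : ContMDiff (𝓡 m) 𝓘(ℝ, V) ∞ f) :
    ContMDiff (𝓡 m) 𝓘(ℝ, V) ∞ (manifoldLap m φ f) := by
  refine contMDiff_of_comp_param fun x₀ y hy => ?_
  refine (contDiffAt_lap (contDiffAt_gram_localImm hφ hy) (posDef_gram_localImm hφ hy).det_pos.ne'
    (contDiffAt_comp_param hf hy)).congr_of_eventuallyEq ?_
  filter_upwards [(isOpen_extChartAt_target x₀).mem_nhds hy] with z hz
  exact manifoldLap_param hφ hf hz

theorem contMDiff_manifoldGradInner (hφ : IsSmoothIsometricImmersion m φ) {f h : M → V}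
    (hf : ContMDiff (𝓡 m) 𝓘(ℝ, V) ∞ f) (hh : ContMDiff (𝓡 m) 𝓘(ℝ, V) ∞ h) :
    ContMDiff (𝓡 m) 𝓘(ℝ, ℝ) ∞ (manifoldGradInner m φ f h) := by
  refine contMDiff_of_comp_param fun x₀ y hy => ?_
  refine (contDiffAt_gradInner (contDiffAt_gram_localImm hφ hy)
    (posDef_gram_localImm hφ hy).det_pos.ne' (contDiffAt_comp_param hf hy)
    (contDiffAt_comp_param hh hy)).congr_of_eventuallyEq ?_
  filter_upwards [(isOpen_extChartAt_target x₀).mem_nhds hy] with z hz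
  exact manifoldGradInner_param hφ hf hh hz

end Chart

/-! ### The Caccioppoli inequality localised in one chart. -/

section Caccioppoli

variable {m n : ℕ} {r : ℝ} {M : Type*} [EMetricSpace M] [SecondCountableTopology M]
  [MeasurableSpace M] [BorelSpace M]
  [ChartedSpace (EuclideanSpace ℝ (Fin m)) M] [IsManifold (𝓡 m) ∞ M]
  [RiemannianBundle (fun x : M => TangentSpace (𝓡 m) x)]
  [IsRiemannianManifold (𝓡 m) M]
  {φ : M → Metric.sphere (0 : EuclideanSpace ℝ (Fin (n + 1))) r} {x₀ : M}
  {V : Type*} [NormedAddCommGroup V] [InnerProductSpace ℝ V]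
  {η : M → ℝ} {L : ℝ≥0} {f : M → V}

/-- Green's formula and the Cauchy–Schwarz inequality in the domain of a chart. -/
theorem integral_mul_manifoldLap_le_of_tsupport_subset (hφ : IsSmoothIsometricImmersion m φ)
    (hη : LipschitzWith L η) (hη0 : ∀ p, 0 ≤ η p) {ρ : M → ℝ} (hρ : ContMDiff (𝓡 m) 𝓘(ℝ, ℝ) ∞ ρ)
    (hρ0 : ∀ p, 0 ≤ ρ p) (hc : HasCompactSupport ρ)
    (hsub : tsupport ρ ⊆ (extChartAt (𝓡 m) x₀).source) (hf : ContMDiff (𝓡 m) 𝓘(ℝ, V) ∞ f) :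
    ∫ p, ρ p * η p ^ 2 * manifoldLap m φ (fun q => (inner ℝ (f q) (f q) : ℝ)) p
        ∂(riemannianVolume m M)
      ≤ ∫ p, (-(η p ^ 2 * manifoldGradInner m φ ρ (fun q => inner ℝ (f q) (f q)) p)
        + ρ p * (η p ^ 2 * manifoldGradInner m φ f f p + 4 * (L : ℝ) ^ 2 * inner ℝ (f p) (f p)))
        ∂(riemannianVolume m M) := by
  set u : M → ℝ := fun q => inner ℝ (f q) (f q) with hudef
  have hu : ContMDiff (𝓡 m) 𝓘(ℝ, ℝ) ∞ u := contMDiff_inner_self hf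
  set T := (extChartAt (𝓡 m) x₀).target with hTdef
  set K := extChartAt (𝓡 m) x₀ '' tsupport ρ with hKdef
  set Φ := localImm m φ x₀ with hΦdef
  have hT : IsOpen T := isOpen_extChartAt_target x₀
  have hK : IsCompact K := hc.image_of_continuousOn ((continuousOn_extChartAt x₀).mono hsub)
  have hKT : K ⊆ T := by
    rintro _ ⟨p, hp, rfl⟩
    exact (extChartAt (𝓡 m) x₀).map_source (hsub hp)
  have hKmem : ∀ y ∈ T, param m x₀ y ∈ tsupport ρ → y ∈ K := fun y hy hp =>
    ⟨_, hp, (extChartAt (𝓡 m) x₀).right_inv hy⟩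
  -- The test function `ρη²` in coordinates, extended by zero since `param` is meaningful only on
  -- the chart's target. It is supported in the compact set `K ⊆ T`, hence globally Lipschitz.
  set h : EuclideanSpace ℝ (Fin m) → ℝ :=
    T.indicator fun y => ρ (param m x₀ y) * (η (param m x₀ y) * η (param m x₀ y)) with hhdef
  have hh : ∀ y ∈ T, h y = ρ (param m x₀ y) * (η (param m x₀ y) * η (param m x₀ y)) :=
    fun y hy => indicator_of_mem hy _
  have h0 : ∀ y ∉ K, h y = 0 := by
    intro y hy
    by_cases hyT : y ∈ T
    · rw [hh y hyT, image_eq_zero_of_notMem_tsupport fun hp => hy (hKmem y hyT hp), zero_mul]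
    · exact indicator_of_notMem hyT _
  have hηl : LocallyLipschitzOn T (η ∘ param m x₀) := locallyLipschitzOn_comp_param hφ hη
  have hloc : LocallyLipschitzOn T h := by
    have := locallyLipschitzOn_mul (locallyLipschitzOn_of_contDiffAt
      fun y hy => contDiffAt_comp_param hρ hy) (locallyLipschitzOn_mul hηl hηl)
    intro y hy
    obtain ⟨C, t, ht, hC⟩ := this hy
    refine ⟨C, t ∩ T, Filter.inter_mem ht self_mem_nhdsWithin, fun a ha b hb => ?_⟩
    rw [hh a ha.2, hh b hb.2]
    exact hC ha.1 hb.1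
  obtain ⟨D, hD⟩ := exists_lipschitzWith_of_locallyLipschitzOn hT hK hKT hloc h0
  have hpos : ∀ y ∈ T, (gram Φ y).PosDef := fun y hy => posDef_gram_localImm hφ hy
  obtain ⟨hint, hgreen⟩ := integral_mul_lap_eq (Φ := Φ) (u := u ∘ param m x₀) hT hK hKT hD h0
    (fun y hy => contDiffAt_localImm hφ hy) (fun y hy => (hpos y hy).det_pos)
    (fun y hy => contDiffAt_comp_param hu hy)
  have hρz : ∀ p ∉ tsupport ρ, ρ p = 0 := fun p hp => image_eq_zero_of_notMem_tsupport hp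
  have hρd : ∀ p ∉ tsupport ρ, manifoldGradInner m φ ρ u p = 0 := fun p hp =>
    manifoldGradInner_eq_zero_of_eventually_const (c := 0)
      (notMem_tsupport_iff_eventuallyEq.1 hp)
  set A : M → ℝ := fun p => ρ p * η p ^ 2 * manifoldLap m φ u p with hA
  set B : M → ℝ := fun p => -(η p ^ 2 * manifoldGradInner m φ ρ u p)
    + ρ p * (η p ^ 2 * manifoldGradInner m φ f f p + 4 * (L : ℝ) ^ 2 * u p) with hB
  have hAc : Continuous A :=
    (hρ.continuous.mul (hη.continuous.pow 2)).mul (contMDiff_manifoldLap hφ hu).continuous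
  have hBc : Continuous B :=
    ((hη.continuous.pow 2).mul (contMDiff_manifoldGradInner hφ hρ hu).continuous).neg.add
      (hρ.continuous.mul (((hη.continuous.pow 2).mul
        (contMDiff_manifoldGradInner hφ hf hf).continuous).add
          (continuous_const.mul hu.continuous)))
  have hA0 : ∀ p ∉ tsupport ρ, A p = 0 := fun p hp => by simp only [hA, hρz p hp, zero_mul]
  have hB0 : ∀ p ∉ tsupport ρ, B p = 0 := fun p hp => by
    simp only [hB, hρz p hp, hρd p hp, zero_mul, mul_zero, neg_zero, add_zero]
  change ∫ p, A p ∂(riemannianVolume m M) ≤ ∫ p, B p ∂(riemannianVolume m M)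
  rw [integral_riemannianVolume (x₀ := x₀) hφ hAc fun p hp => hA0 p fun h => hp (hsub h),
    integral_riemannianVolume (x₀ := x₀) hφ hBc fun p hp => hB0 p fun h => hp (hsub h)]
  have e1 : ∫ y in T, Real.sqrt (gram Φ y).det * A (param m x₀ y)
      = ∫ y, Real.sqrt (gram Φ y).det * (h y * lap (gram Φ) (u ∘ param m x₀) y) := by
    refine (setIntegral_congr_fun hT.measurableSet fun y hy => ?_).trans
      (setIntegral_eq_integral_of_forall_compl_eq_zero (s := T) fun y hy => by
        rw [h0 y fun hyK => hy (hKT hyK), zero_mul, mul_zero])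
    simp only [hA, hh y hy, manifoldLap_param hφ hu hy]
    ring
  rw [e1, hgreen, ← integral_neg, ← integral_indicator hT.measurableSet]
  have hBK : ∀ y ∉ K, T.indicator (fun y => Real.sqrt (gram Φ y).det * B (param m x₀ y)) y = 0 := by
    intro y hy
    by_cases hyT : y ∈ T
    · rw [indicator_of_mem hyT, hB0 _ fun hp => hy (hKmem y hyT hp), mul_zero]
    · exact indicator_of_notMem hyT _
  refine integral_mono_ae hint.neg (integrable_of_continuousOn_of_eq_zero hK ?_ hBK) ?_
  · refine ContinuousOn.congr (f := fun y => Real.sqrt (gram Φ y).det * B (param m x₀ y))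
      (fun y hy => ?_) fun y hy => indicator_of_mem (hKT hy) _
    exact ((continuousAt_sqrt_det_gram hφ (hKT hy)).mul (hBc.continuousAt.comp
      (contMDiffAt_param (hKT hy)).continuousAt)).continuousWithinAt
  · filter_upwards [ae_differentiableAt_of_locallyLipschitzOn hT hηl] with y hy
    by_cases hyT : y ∈ T
    · have hev : h =ᶠ[nhds y] fun z => (ρ ∘ param m x₀) z *
          ((η ∘ param m x₀) z * (η ∘ param m x₀) z) := by
        filter_upwards [hT.mem_nhds hyT] with z hz using hh z hz
      have key := neg_sum_gradient_mul_le (hpos y hyT)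
        (contDiffAt_comp_param hf hyT).differentiableAt_of_infty
        (contDiffAt_comp_param hρ hyT).differentiableAt_of_infty (hy hyT)
        (hρ0 _) (hη0 _) L.coe_nonneg (abs_fderiv_comp_param_le hφ hη hyT (hy hyT))
      rw [indicator_of_mem hyT]
      simp only [hB, manifoldGradInner_param hφ hρ hu hyT, manifoldGradInner_param hφ hf hf hyT,
        partialD_congr hev]
      rw [← mul_neg]
      exact mul_le_mul_of_nonneg_left key (Real.sqrt_nonneg _)
    · have hev : h =ᶠ[nhds y] fun _ => 0 := by
        filter_upwards [hK.isClosed.isOpen_compl.mem_nhds fun hyK => hyT (hKT hyK)] with z hz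
        exact h0 z hz
      have hd : ∀ i, partialD i h y = 0 := fun i => by
        rw [partialD_congr hev]
        simp [partialD]
      rw [indicator_of_notMem hyT]
      simp only [hd, mul_zero, Finset.sum_const_zero, neg_zero, le_refl]

end Caccioppoli

/-! ### The global Caccioppoli inequality through a partition of unity. -/

section Global

variable {m n : ℕ} {r : ℝ} {M : Type*} [EMetricSpace M] [SecondCountableTopology M]
  [ChartedSpace (EuclideanSpace ℝ (Fin m)) M] [IsManifold (𝓡 m) ∞ M]

/-- A partition of unity over a compact set by functions supported in domains of charts. -/
theorem exists_finset_partition_of_unity {C : Set M} (hC : IsCompact C) :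
    ∃ (J : Finset M) (ρ : M → M → ℝ), (∀ j, ContMDiff (𝓡 m) 𝓘(ℝ, ℝ) ∞ (ρ j)) ∧
      (∀ j p, 0 ≤ ρ j p) ∧ (∀ j, HasCompactSupport (ρ j)) ∧
      (∀ j, tsupport (ρ j) ⊆ (extChartAt (𝓡 m) j).source) ∧ (∀ p, ∑ j ∈ J, ρ j p ≤ 1) ∧
      ∀ p ∈ C, ∑ j ∈ J, ρ j p = 1 := by
  have : LocallyCompactSpace M := ChartedSpace.locallyCompactSpace (EuclideanSpace ℝ (Fin m)) M
  -- Subordination to the interiors of compact sets makes the supports compact as well as contained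
  -- in chart domains.
  choose Q hQ hxQ hQs using fun x : M => exists_compact_subset
    (isOpen_extChartAt_source (I := 𝓡 m) x) (mem_extChartAt_source (I := 𝓡 m) x)
  obtain ⟨ρ, hρ⟩ := SmoothPartitionOfUnity.exists_isSubordinate (𝓡 m) (s := (univ : Set M))
    isClosed_univ (fun x => interior (Q x)) (fun x => isOpen_interior)
    fun x _ => mem_iUnion.2 ⟨x, hxQ x⟩
  have hfin := ρ.locallyFinite.finite_nonempty_inter_compact hC
  have hle : ∀ (J : Finset M) (p : M), ∑ j ∈ J, ρ j p ≤ 1 := by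
    classical
    intro J p
    rw [← ρ.sum_finsupport' p (mem_univ p)
      (Finset.subset_union_left : ρ.finsupport p ⊆ ρ.finsupport p ∪ J)]
    exact Finset.sum_le_sum_of_subset_of_nonneg Finset.subset_union_right
      fun j _ _ => ρ.nonneg j p
  refine ⟨hfin.toFinset, fun j => ρ j, fun j => (ρ j).contMDiff, ρ.nonneg, fun j => ?_, fun j => ?_,
    hle _, fun p hp => ?_⟩
  · exact (hQ j).of_isClosed_subset (isClosed_tsupport _) ((hρ j).trans interior_subset)
  · exact ((hρ j).trans interior_subset).trans (hQs j)
  · refine ρ.sum_finsupport' p (mem_univ p) fun j hj => ?_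
    rw [hfin.mem_toFinset]
    exact ⟨p, (ρ.mem_finsupport p).1 hj, hp⟩

variable [MeasurableSpace M] [BorelSpace M]
  [RiemannianBundle (fun x : M => TangentSpace (𝓡 m) x)]
  [IsRiemannianManifold (𝓡 m) M]
  {φ : M → Metric.sphere (0 : EuclideanSpace ℝ (Fin (n + 1))) r}
  {V : Type*} [NormedAddCommGroup V] [InnerProductSpace ℝ V]
  {η : M → ℝ} {L : ℝ≥0} {f : M → V}

/-- The Caccioppoli inequality. -/
theorem integral_sq_mul_manifoldLap_sub_le (hφ : IsSmoothIsometricImmersion m φ)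
    (hη : LipschitzWith L η) (hη0 : ∀ p, 0 ≤ η p) (hc : HasCompactSupport η)
    (hf : ContMDiff (𝓡 m) 𝓘(ℝ, V) ∞ f)
    (hint : Integrable (fun p => (inner ℝ (f p) (f p) : ℝ)) (riemannianVolume m M)) :
    ∫ p, η p ^ 2 * (manifoldLap m φ (fun q => (inner ℝ (f q) (f q) : ℝ)) p
        - manifoldGradInner m φ f f p) ∂(riemannianVolume m M)
      ≤ 4 * (L : ℝ) ^ 2 * ∫ p, (inner ℝ (f p) (f p) : ℝ) ∂(riemannianVolume m M) := by
  have := isLocallyFiniteMeasure_riemannianVolume hφ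
  set μ := riemannianVolume m M
  set u : M → ℝ := fun q => inner ℝ (f q) (f q) with hudef
  have hu : ContMDiff (𝓡 m) 𝓘(ℝ, ℝ) ∞ u := contMDiff_inner_self hf
  set Δ : M → ℝ := manifoldLap m φ u
  set e : M → ℝ := manifoldGradInner m φ f f
  have hΔc : Continuous Δ := (contMDiff_manifoldLap hφ hu).continuous
  have hec : Continuous e := (contMDiff_manifoldGradInner hφ hf hf).continuous
  have hη2 : Continuous fun p => η p ^ 2 := hη.continuous.pow 2
  obtain ⟨J, ρ, hρ, hρ0, hρc, hρs, hle, h1⟩ := exists_finset_partition_of_unity (m := m) hc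
  have hρcont : ∀ j, Continuous (ρ j) := fun j => (hρ j).continuous
  have hgc : ∀ j, Continuous (manifoldGradInner m φ (ρ j) u) := fun j =>
    (contMDiff_manifoldGradInner hφ (hρ j) hu).continuous
  have hη2c : HasCompactSupport fun p => η p ^ 2 := HasCompactSupport.intro hc fun p hp => by
    rw [image_eq_zero_of_notMem_tsupport hp]
    simp
  have hI1 : ∀ g : M → ℝ, Continuous g → Integrable (fun p => η p ^ 2 * g p) μ := fun g hg =>
    (hη2.mul hg).integrable_of_hasCompactSupport hη2c.mul_right
  have hI2 : ∀ j, ∀ g : M → ℝ, Continuous g → Integrable (fun p => ρ j p * g p) μ := fun j g hg =>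
    ((hρcont j).mul hg).integrable_of_hasCompactSupport (hρc j).mul_right
  have hsum : ∀ p, η p ≠ 0 → ∑ j ∈ J, ρ j p = 1 := fun p hp =>
    h1 p (subset_tsupport _ hp)
  -- Where `η ≠ 0` the functions `ρ j` sum to `1` on a whole neighbourhood, so their gradients
  -- cancel.
  have hgrad : ∀ p, η p ^ 2 * ∑ j ∈ J, manifoldGradInner m φ (ρ j) u p = 0 := by
    intro p
    by_cases hp : η p = 0
    · simp [hp]
    · rw [sum_manifoldGradInner J hρ, manifoldGradInner_eq_zero_of_eventually_const (c := 1),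
        mul_zero]
      filter_upwards [hη.continuous.continuousAt.eventually_ne hp] with q hq using hsum q hq
  have hF : ∀ j, Integrable (fun p => -(η p ^ 2 * manifoldGradInner m φ (ρ j) u p)
      + ρ j p * (η p ^ 2 * e p + 4 * (L : ℝ) ^ 2 * u p)) μ := fun j =>
    (hI1 _ (hgc j)).neg.add (hI2 j _ ((hη2.mul hec).add (continuous_const.mul hu.continuous)))
  have hG : ∀ j, Integrable (fun p => ρ j p * η p ^ 2 * Δ p) μ := fun j => by
    simp only [mul_assoc]
    exact hI2 j _ (hη2.mul hΔc)
  have hkey := Finset.sum_le_sum fun j (_ : j ∈ J) =>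
    integral_mul_manifoldLap_le_of_tsupport_subset hφ hη hη0 (hρ j) (hρ0 j) (hρc j) (hρs j) hf
  rw [← integral_finsetSum _ fun j _ => hG j, ← integral_finsetSum _ fun j _ => hF j] at hkey
  have e1 : ∀ p, ∑ j ∈ J, ρ j p * η p ^ 2 * Δ p = η p ^ 2 * Δ p := by
    intro p
    by_cases hp : η p = 0
    · simp [hp]
    · simp only [← Finset.sum_mul, hsum p hp, one_mul]
  have e2 : ∀ p, ∑ j ∈ J, (-(η p ^ 2 * manifoldGradInner m φ (ρ j) u p)
      + ρ j p * (η p ^ 2 * e p + 4 * (L : ℝ) ^ 2 * u p)) ≤ η p ^ 2 * e p + 4 * (L : ℝ) ^ 2 * u p := by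
    intro p
    rw [Finset.sum_add_distrib, Finset.sum_neg_distrib, ← Finset.mul_sum, hgrad, neg_zero, zero_add,
      ← Finset.sum_mul]
    have he : 0 ≤ e p := manifoldGradInner_self_nonneg hφ f p
    have hup : 0 ≤ u p := real_inner_self_nonneg
    exact mul_le_of_le_one_left (by positivity) (hle p)
  have h2 : ∫ p, η p ^ 2 * Δ p ∂μ ≤ ∫ p, (η p ^ 2 * e p + 4 * (L : ℝ) ^ 2 * u p) ∂μ := by
    refine (le_of_eq ?_).trans (hkey.trans (integral_mono (integrable_finsetSum _ fun j _ => hF j)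
      ((hI1 e hec).add (hint.const_mul _)) e2))
    exact integral_congr_ae (Filter.Eventually.of_forall fun p => (e1 p).symm)
  rw [integral_add (hI1 e hec) (hint.const_mul _), integral_const_mul] at h2
  simp only [mul_sub]
  rw [integral_sub (hI1 Δ hΔc) (hI1 e hec)]
  linarith

end Global

/-! ### Vanishing of the tension field on complete manifolds. -/

section Rigidity

variable {m n : ℕ} {K : ℝ} {M : Type*} [EMetricSpace M] [SecondCountableTopology M]
  [MeasurableSpace M] [BorelSpace M]
  [ChartedSpace (EuclideanSpace ℝ (Fin m)) M] [IsManifold (𝓡 m) ∞ M]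
  [RiemannianBundle (fun x : M => TangentSpace (𝓡 m) x)]
  [IsRiemannianManifold (𝓡 m) M]
  {φ : M → Metric.sphere (0 : EuclideanSpace ℝ (Fin (n + 1))) (1 / Real.sqrt K)}

/-- On a complete manifold, an isometric immersion whose tension field is a square integrable
eigensection with nonnegative eigenvalue is harmonic. -/
theorem isHarmonic_of_integrable [CompleteSpace M] (hK : 0 < K)
    (hφ : IsSmoothIsometricImmersion m φ) {c : ℝ} (hc : 0 ≤ c)
    (heq : ∀ p, connLaplacian m φ (tensionField m φ) p = c • tensionField m φ p)
    (hint : Integrable (fun p => (inner ℝ (tensionField m φ p) (tensionField m φ p) : ℝ))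
      (riemannianVolume m M)) : IsHarmonic m φ := by
  have : LocallyCompactSpace M := ChartedSpace.locallyCompactSpace (EuclideanSpace ℝ (Fin m)) M
  have := isLocallyFiniteMeasure_riemannianVolume hφ
  have := isOpenPosMeasure_riemannianVolume hφ
  have hτ := contMDiff_tensionField hK hφ
  intro x
  set μ := riemannianVolume m M
  set u : M → ℝ := fun p => inner ℝ (tensionField m φ p) (tensionField m φ p) with hudef
  set e : M → ℝ := manifoldGradInner m φ (tensionField m φ) (tensionField m φ) with hedef
  have hu0 : ∀ p, 0 ≤ u p := fun p => real_inner_self_nonneg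
  have he0 : ∀ p, 0 ≤ e p := manifoldGradInner_self_nonneg hφ _
  have hec : Continuous e := (contMDiff_manifoldGradInner hφ hτ hτ).continuous
  set B : Set M := Metric.eball x 1 with hBdef
  have hB : IsOpen B := Metric.isOpen_eball
  set S := ∫ p, u p ∂μ with hS
  -- The ball `B` stays fixed while the cut-off spreads out, so the bound tends to zero as `R → ∞`.
  have key : ∀ R : ℝ, 0 < R → IntegrableOn e B μ ∧ ∫ p in B, e p ∂μ ≤ 4 * R⁻¹ ^ 2 * S := by
    intro R hR
    obtain ⟨η, hηL, hηc, hη0, -, hηx⟩ := exists_lipschitzWith_cutoff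
      (hasAlmostMidpoints_of_isRiemannianManifold m M) x hR
    have h1 := integral_sq_mul_manifoldLap_sub_le hφ hηL hη0 hηc hτ hint
    have h2 : ∀ g : M → ℝ, Continuous g → Integrable (fun p => η p ^ 2 * g p) μ := fun g hg =>
      ((hηL.continuous.pow 2).mul hg).integrable_of_hasCompactSupport
        (HasCompactSupport.intro hηc fun p hp => by
          simp [image_eq_zero_of_notMem_tsupport hp])
    have h3 : EqOn (fun p => η p ^ 2 * e p) e B := fun p hp => by
      simp only [hηx p hp, one_pow, one_mul]
    have h4 : ∫ p in B, e p ∂μ ≤ ∫ p, η p ^ 2 * e p ∂μ := by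
      rw [← setIntegral_congr_fun hB.measurableSet h3]
      exact setIntegral_le_integral (h2 e hec) (Filter.Eventually.of_forall fun p =>
        mul_nonneg (sq_nonneg _) (he0 p))
    -- By the Bochner identity `Δu - e = 2cu + e`; this is where `c ≥ 0` enters.
    have h5 : ∫ p, η p ^ 2 * e p ∂μ ≤ ∫ p, η p ^ 2 * (manifoldLap m φ u p - e p) ∂μ := by
      refine integral_mono (h2 e hec)
        (h2 _ ((contMDiff_manifoldLap hφ (contMDiff_inner_self hτ)).continuous.sub hec)) fun p => ?_
      refine mul_le_mul_of_nonneg_left ?_ (sq_nonneg _)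
      rw [manifoldLap_inner_tensionField hK hφ heq p]
      have h6 : 0 ≤ c * u p := mul_nonneg hc (hu0 p)
      have h7 := he0 p
      linarith
    have h8 : ((R.toNNReal⁻¹ : ℝ≥0) : ℝ) = R⁻¹ := by
      rw [NNReal.coe_inv, Real.coe_toNNReal R hR.le]
    rw [h8] at h1
    exact ⟨(integrableOn_congr_fun h3 hB.measurableSet).1 (h2 e hec).integrableOn,
      h4.trans (h5.trans h1)⟩
  have hI : ∫ p in B, e p ∂μ ≤ 0 := by
    have hlim : Filter.Tendsto (fun R : ℝ => 4 * R⁻¹ ^ 2 * S) Filter.atTop (nhds (4 * 0 ^ 2 * S)) :=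
      ((tendsto_inv_atTop_zero.pow 2).const_mul 4).mul_const S
    refine (ge_of_tendsto hlim ?_).trans_eq (by ring)
    filter_upwards [Filter.eventually_gt_atTop 0] with R hR using (key R hR).2
  have hI0 : ∫ p in B, e p ∂μ = 0 := le_antisymm hI (integral_nonneg he0)
  have hae : e =ᵐ[μ.restrict B] 0 :=
    (integral_eq_zero_iff_of_nonneg he0 (key 1 one_pos).1).1 hI0
  exact tensionField_eq_zero hK hφ (Measure.eqOn_open_of_ae_eq hae hB hec.continuousOn
    continuousOn_const (Metric.mem_eball_self one_pos))

end Rigidity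

end SphereImmersion

end

/-! ### The closed case and the complete case. -/

theorem mainTheorem4 (m n : ℕ) {M : Type*} [EMetricSpace M] [SecondCountableTopology M]
    [MeasurableSpace M] [BorelSpace M]
    [ChartedSpace (EuclideanSpace ℝ (Fin m)) M] [IsManifold (𝓡 m) ∞ M]
    [RiemannianBundle (fun x : M => TangentSpace (𝓡 m) x)]
    [IsContMDiffRiemannianBundle (𝓡 m) ∞ (EuclideanSpace ℝ (Fin m))
      (fun x : M => TangentSpace (𝓡 m) x)]
    [IsRiemannianManifold (𝓡 m) M]
    (K δ₁ δ₂ : ℝ) (hK : 0 < K) (hδ₂ : δ₂ ≠ 0)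
    (φ : M → Metric.sphere (0 : EuclideanSpace ℝ (Fin (n + 1))) (1 / Real.sqrt K))
    (hφ : SphereImmersion.IsSmoothIsometricImmersion m φ)
    (heq : ∀ p : M,
      SphereImmersion.connLaplacian m φ (SphereImmersion.tensionField m φ) p
        = (-((m : ℝ) * K) + δ₁ / δ₂) • SphereImmersion.tensionField m φ p)
    (hsign : 0 ≤ -((m : ℝ) * K) + δ₁ / δ₂) :
    (CompactSpace M → SphereImmersion.IsHarmonic m φ) ∧
    (CompleteSpace M → NoncompactSpace M → SphereImmersion.bienergy m φ < ⊤ →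
      SphereImmersion.IsHarmonic m φ) := by
  have hu : Continuous fun p => (inner ℝ (SphereImmersion.tensionField m φ p)
      (SphereImmersion.tensionField m φ p) : ℝ) :=
    (SphereImmersion.contMDiff_inner_self
      (SphereImmersion.contMDiff_tensionField hK hφ)).continuous
  have := SphereImmersion.isLocallyFiniteMeasure_riemannianVolume hφ
  refine ⟨fun _ => ?_, fun _ _ hE => ?_⟩
  -- Compactness supplies completeness, and it makes the continuous function `|τ|²` integrable.
  · exact SphereImmersion.isHarmonic_of_integrable hK hφ hsign heq
      (hu.integrable_of_hasCompactSupport (HasCompactSupport.of_compactSpace _))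
  · refine SphereImmersion.isHarmonic_of_integrable hK hφ hsign heq
      ⟨hu.aestronglyMeasurable, ?_⟩
    -- For the nonnegative function `|τ|²`, finiteness of the integral is exactly finiteness of the
    -- bienergy.
    rw [hasFiniteIntegral_iff_ofReal (Filter.Eventually.of_forall fun p => real_inner_self_nonneg)]
    simp only [real_inner_self_eq_norm_sq]
    exact hE
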